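/- For $d\ge 1$ let $\|\cdot\|$ be the $\ell_\infty$-norm on $\mathbb{R}^d$. For $x\in\mathbb{R}^d$, $i\in\{1,\dots,d\}$ and $s\in\{-1,+1\}$, the pyramid with apex $x$, direction $i$ and sign $s$ is $$P_i^s(x)=\{y\in\mathbb{R}^d : s(y_i-x_i)=\|y-x\|\}.$$ A set $X\subseteq[0,1]^d$ is a valid search space of complexity $n$ if $X=[0,1]^d\setminus\bigcup_{k=1}^n P^{(k)}$ for some $n$ pyramids $P^{(1)},\dots,P^{(n)}$. **Lemma (Volume Computation).** There are a single deterministic algorithm and an absolute constant $C$ such that the following holds for all $d\ge 1$, $n\ge 0$. Given $d$, $n$, the triples (apex, direction, sign) of $n$ pyramids $P^{(1)},\dots,P^{(n)}$ in $\mathbb{R}^d$ presenting a valid search space $X=[0,1]^d\setminus\bigcup_{k=1}^n P^{(k)}$, and the triple of a further arbitrary pyramid $P$ in $\mathbb{R}^d$, the algorithm halts and outputs exactly the Lebesgue measure $\mathrm{vol}(X\cap P)$, in time $(nd)^{O(d)}$: it takes at most $(nd)^{Cd}$ steps whenever $nd\ge 2$, and in general at most $\max\{2,\max\{1,n\}\,d\}^{Cd}$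 steps. Running time is counted in the real-RAM model: every arithmetic operation ($+,-,\cdot,/$) or comparison on real numbers, every addition, (truncated) subtraction or comparison of natural numbers used as counters and addresses, every conversion of such a number to a real number, every memory access (with indirect addressing) and every control step costs a constant number of steps. The only real constants are rational, there is no rounding of reals to integers, and all memory cells not holding the input are initially $0$. -/

import Mathlib

open MeasureTheory

/-- The data `(x, i, s)` of a pyramid in `ℝ^d`: apex `x`, direction `i`, and a sign `s`
(`pos = true` stands for `s = +1`, `pos = false` for `s = -1`). -/
structure Pyramid (d : ℕ) where
  apex : Fin d → ℝ
  dir : Fin d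
  pos : Bool

/-- The sign `s ∈ {-1, +1}` of a pyramid. -/
def Pyramid.sign {d : ℕ} (P : Pyramid d) : ℝ := if P.pos then 1 else -1

/-- The point set `{y | s * (y i - x i) = ‖y - x‖}` of a pyramid.
The norm on `Fin d → ℝ` is the maximum norm. -/
def Pyramid.toSet {d : ℕ} (P : Pyramid d) : Set (Fin d → ℝ) :=
  {y | P.sign * (y P.dir - P.apex P.dir) = ‖y - P.apex‖}

/-- The valid search space `[0,1]^d \ ⋃ k, Q k` presented by `n` pyramids `Q 0, …, Q (n-1)`. -/
def searchSpace {d n : ℕ} (Q : Fin n → Pyramid d) : Set (Fin d → ℝ) :=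
  Set.Icc 0 1 \ ⋃ k, (Q k).toSet

/-- `X` is a valid search space of complexity `n`, and the list of pyramids `Q` witnesses it. -/
def IsValidSearchSpaceVia {d n : ℕ} (X : Set (Fin d → ℝ)) (Q : Fin n → Pyramid d) : Prop :=
  X = searchSpace Q

/-! The machine model: a real RAM, presented as a small imperative language with unit-cost
operations. The memory consists of arrays of natural numbers (used for counting, addressing and
control) and arrays of real numbers, both with indirect addressing. Naturals can only be added,
subtracted (truncated) and compared, so that unit cost hides no arithmetic on long integers.
Reals can be added, subtracted, multiplied, divided and compared exactly; there is no rounding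
from reals to integers, and the only real constants are rational. -/

namespace RealRAM

/-- A memory state: `nat a k` and `real a k` are the `k`-th cells of the arrays named `a`. -/
@[ext] structure State where
  nat : ℕ → ℕ → ℕ
  real : ℕ → ℕ → ℝ

/-- Expressions with values in `ℕ`. -/
inductive NExpr where
  | const (k : ℕ)
  | get (a : ℕ) (i : NExpr)
  | add (e f : NExpr)
  | sub (e f : NExpr)

/-- Expressions with values in `ℝ`. -/
inductive RExpr where
  | const (q : ℚ)
  | get (a : ℕ) (i : NExpr)
  | ofNat (e : NExpr)
  | add (e f : RExpr)
  | sub (e f : RExpr)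
  | mul (e f : RExpr)
  | div (e f : RExpr)

/-- Tests. -/
inductive BExpr where
  | natLt (e f : NExpr)
  | realLt (e f : RExpr)
  | not (b : BExpr)
  | and (b c : BExpr)

/-- Programs. -/
inductive Prog where
  | skip
  | setNat (a : ℕ) (i e : NExpr)
  | setReal (a : ℕ) (i : NExpr) (e : RExpr)
  | seq (p q : Prog)
  | ite (b : BExpr) (p q : Prog)
  | loop (b : BExpr) (p : Prog)

def NExpr.eval (σ : State) : NExpr → ℕ
  | .const k => k
  | .get a i => σ.nat a (i.eval σ)
  | .add e f => e.eval σ + f.eval σ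
  | .sub e f => e.eval σ - f.eval σ

/-- Division by zero returns zero, which a program can tell apart by a comparison. -/
noncomputable def RExpr.eval (σ : State) : RExpr → ℝ
  | .const q => (q : ℝ)
  | .get a i => σ.real a (i.eval σ)
  | .ofNat e => (e.eval σ : ℝ)
  | .add e f => e.eval σ + f.eval σ
  | .sub e f => e.eval σ - f.eval σ
  | .mul e f => e.eval σ * f.eval σ
  | .div e f => e.eval σ / f.eval σ

def BExpr.Holds (σ : State) : BExpr → Prop
  | .natLt e f => e.eval σ < f.eval σ
  | .realLt e f => e.eval σ < f.eval σ
  | .not b => ¬ b.Holds σ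
  | .and b c => b.Holds σ ∧ c.Holds σ

/-- The cost of evaluating an expression: one unit per constant, memory access and operation. -/
def NExpr.cost : NExpr → ℕ
  | .const _ => 1
  | .get _ i => i.cost + 1
  | .add e f => e.cost + f.cost + 1
  | .sub e f => e.cost + f.cost + 1

/-- As for `NExpr.cost`: one unit per constant, memory access and operation. -/
def RExpr.cost : RExpr → ℕ
  | .const _ => 1
  | .get _ i => i.cost + 1
  | .ofNat e => e.cost + 1
  | .add e f => e.cost + f.cost + 1
  | .sub e f => e.cost + f.cost + 1
  | .mul e f => e.cost + f.cost + 1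
  | .div e f => e.cost + f.cost + 1

/-- As for `NExpr.cost`: one unit per constant, memory access and operation. -/
def BExpr.cost : BExpr → ℕ
  | .natLt e f => e.cost + f.cost + 1
  | .realLt e f => e.cost + f.cost + 1
  | .not b => b.cost + 1
  | .and b c => b.cost + c.cost + 1

def State.setNat (σ : State) (a k v : ℕ) : State where
  nat b j := if b = a ∧ j = k then v else σ.nat b j
  real := σ.real

noncomputable def State.setReal (σ : State) (a k : ℕ) (v : ℝ) : State where
  nat := σ.nat
  real b j := if b = a ∧ j = k then v else σ.real b j

/-- `Runs p σ t τ`: started in the state `σ`, the program `p` halts in the state `τ` after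
exactly `t` steps. -/
inductive Runs : Prog → State → ℕ → State → Prop
  | skip (σ : State) : Runs .skip σ 1 σ
  | setNat (σ : State) (a : ℕ) (i e : NExpr) :
      Runs (.setNat a i e) σ (i.cost + e.cost + 1) (σ.setNat a (i.eval σ) (e.eval σ))
  | setReal (σ : State) (a : ℕ) (i : NExpr) (e : RExpr) :
      Runs (.setReal a i e) σ (i.cost + e.cost + 1) (σ.setReal a (i.eval σ) (e.eval σ))
  | seq {p q : Prog} {σ τ υ : State} {s t : ℕ} :
      Runs p σ s τ → Runs q τ t υ → Runs (.seq p q) σ (s + t) υ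
  | ite_true {b : BExpr} {p q : Prog} {σ τ : State} {t : ℕ} :
      b.Holds σ → Runs p σ t τ → Runs (.ite b p q) σ (b.cost + t + 1) τ
  | ite_false {b : BExpr} {p q : Prog} {σ τ : State} {t : ℕ} :
      ¬ b.Holds σ → Runs q σ t τ → Runs (.ite b p q) σ (b.cost + t + 1) τ
  | loop_stop {b : BExpr} {p : Prog} {σ : State} :
      ¬ b.Holds σ → Runs (.loop b p) σ (b.cost + 1) σ
  | loop_step {b : BExpr} {p : Prog} {σ τ υ : State} {s t : ℕ} :
      b.Holds σ → Runs p σ s τ → Runs (.loop b p) τ t υ →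
      Runs (.loop b p) σ (b.cost + s + t + 1) υ

/-- The initial memory holding `m` pyramids in `ℝ^d`, and an extra number `n`:
* natural array `0` holds `d` in cell `0` and `n` in cell `1`;
* natural array `1` holds the direction (counted from `0`) of pyramid `k` in cell `k`;
* natural array `2` holds the sign of pyramid `k` in cell `k` (`1` for `+1`, `0` for `-1`);
* real array `0` holds coordinate `j` of the apex of pyramid `k` in cell `k * d + j`;
* all other cells are `0`. -/
noncomputable def encode {d m : ℕ} (n : ℕ) (R : Fin m → Pyramid d) : State where
  nat a j :=
    if a = 0 then (if j = 0 then d else if j = 1 then n else 0)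
    else if a = 1 then (if h : j < m then ((R ⟨j, h⟩).dir : ℕ) else 0)
    else if a = 2 then (if h : j < m then (if (R ⟨j, h⟩).pos then 1 else 0) else 0)
    else 0
  real a j :=
    if a = 0 then
      (if h : j < m * d then
        (R (Fin.divNat ⟨j, h⟩)).apex (Fin.modNat ⟨j, h⟩) else 0)
    else 0

/-- The input of the volume problem: the dimension `d`, the number `n`, the pyramids
`Q 0, …, Q (n-1)` that present the search space, and, as pyramid number `n`, the query `P`. -/
noncomputable def volumeInput {d n : ℕ} (Q : Fin n → Pyramid d) (P : Pyramid d) : State :=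
  encode n (Fin.snoc (α := fun _ => Pyramid d) Q P)

/-- The output of a computation is read off from cell `0` of the real array `1`. -/
def State.output (σ : State) : ℝ := σ.real 1 0

end RealRAM

/-!
The set `X ∩ P` is described by the signs of `N = 2 * d * (n + 2)` affine functions: the pyramid
`(x, i, s)` consists of the points with `s * (y i - x i) ± (y j - x j) ≥ 0` for all `j`, and the
cube of those with `y j ≥ 0` and `1 - y j ≥ 0`. So the indicator function of `X ∩ P` is
`φ (negSet y)`, where `negSet y` is the set of the functions that are negative at `y`
(`spaceIndicator_negSet`), and the volume is an integral over an arrangement of hyperplanes.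

More generally, for an affine function `c` consider the integral of `φ (negSet y) * c y ^ m / m!`.
The integral over the last coordinate is computed by the fundamental theorem of calculus: if `c`
depends on this coordinate with coefficient `γ`, then `c ^ (m + 1) / ((m + 1)! * γ)` is an
antiderivative, and only the jumps of `φ (negSet y)` contribute (`integral_signPattern_mul`). These
occur on hyperplanes of the arrangement. On each of them, the last coordinate is an affine function
of the others, and substituting it gives an integral of the same kind in one dimension less
(`reduceRows`). Functions that vanish on the same hyperplane as the chosen one are treated as
if their signs changed one after the other in the order of their indices, and become constants of
the corresponding sign; all other functions are nonzero almost everywhere on the hyperplane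
(`negSet_reduceRows`). After `d` steps the integral is a sum of `(2 * N) ^ d` terms, one for each
choice of a hyperplane and one of its sides in each step (`Admissible.integral_eq_sum`).

For this, `c` must never become constant along the next coordinate. The coefficients of `c` are
chosen as different powers of `2`. The equations of the hyperplanes have the form `y j = const` or
`y j = ± y l + const`, which persists under substitution, so that each substitution adds or
subtracts coefficients of `c` of higher 2-adic valuation, and never makes a coefficient vanish
(`Admissible.reduceRows_pivot`).

The program runs through all vectors of `d` digits below `2 * N`, performs the eliminations that the
digits prescribe, and adds up the terms. Its correctness is proved with a program logic, in which
the running time of counting loops is controlled by a syntactic budget (`Halts`). One term costs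
time polynomial in `N`, and there are `(2 * N) ^ d` terms, which is at most `M ^ (5 * d)` for
`M = max 2 (max 1 n * d)`.
-/

/-! ### Integrating out one variable -/

/-- A function of finite sets telescopes along the chain of the initial segments of a linear
order. -/
theorem sum_jumps_eq_sub {ι κ : Type*} [DecidableEq ι] [LinearOrder κ] {key : ι → κ}
    (hkey : Function.Injective key) (ψ : Finset ι → ℝ) (J U : Finset ι) (hU : U ⊆ J)
    (hlow : ∀ i ∈ U, ∀ x ∈ J, key x ≤ key i → x ∈ U) :
    ∑ j ∈ U, (ψ (J.filter (key · ≤ key j)) - ψ (J.filter (key · < key j))) = ψ U - ψ ∅ := by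
  induction U using Finset.induction_on_max_value key with
  | empty => simp
  | insert a s ha hmax ih =>
    have hle : J.filter (key · ≤ key a) = insert a s := by
      ext x
      simp only [Finset.mem_filter, Finset.mem_insert]
      constructor
      · rintro ⟨hx, hxa⟩
        exact Finset.mem_insert.1 (hlow a (Finset.mem_insert_self _ _) x hx hxa)
      · rintro (rfl | hx)
        · exact ⟨hU (Finset.mem_insert_self _ _), le_rfl⟩
        · exact ⟨hU (Finset.mem_insert_of_mem hx), hmax x hx⟩
    have hlt : J.filter (key · < key a) = s := by
      ext x
      simp only [Finset.mem_filter]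
      constructor
      · rintro ⟨hx, hxa⟩
        rcases Finset.mem_insert.1 (hlow a (Finset.mem_insert_self _ _) x hx hxa.le) with rfl | h
        · exact absurd hxa (lt_irrefl _)
        · exact h
      · intro hx
        refine ⟨hU (Finset.mem_insert_of_mem hx), lt_of_le_of_ne (hmax x hx) fun h => ?_⟩
        exact ha (hkey h ▸ hx)
    rw [Finset.sum_insert ha, hle, hlt, ih (fun x hx => hU (Finset.mem_insert_of_mem hx))]
    · ring
    · intro i hi x hx hxi
      rcases Finset.mem_insert.1 (hlow i (Finset.mem_insert_of_mem hi) x hx hxi) with rfl | h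
      · have : key x = key i := le_antisymm hxi (hmax i hi)
        exact (hkey this) ▸ hi
      · exact h

/-- The indices of the affine functions `t ↦ β i + α i * t` that are negative once exactly the
zeros of those with index in `U` have been passed. -/
noncomputable def passedNeg (N : ℕ) (α β : ℕ → ℝ) (U : Finset ℕ) : Finset ℕ :=
  (Finset.range N).filter fun i =>
    if α i = 0 then β i < 0 else if i ∈ U then α i < 0 else 0 < α i

/-- The order in which the zeros of `t ↦ β i + α i * t` are passed; equal zeros are passed in the
order of their indices. -/
noncomputable def passKey (α β : ℕ → ℝ) (i : ℕ) : ℝ ×ₗ ℕ := toLex (-β i / α i, i)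

theorem passKey_injective (α β : ℕ → ℝ) : Function.Injective (passKey α β) := by
  intro i j h
  exact congrArg (fun p => (ofLex p).2) h

theorem passKey_lt {α β : ℕ → ℝ} {i j : ℕ} : passKey α β i < passKey α β j ↔
    -β i / α i < -β j / α j ∨ -β i / α i = -β j / α j ∧ i < j := by
  simp [passKey, Prod.Lex.toLex_lt_toLex]

theorem passKey_le {α β : ℕ → ℝ} {i j : ℕ} : passKey α β i ≤ passKey α β j ↔
    -β i / α i < -β j / α j ∨ -β i / α i = -β j / α j ∧ i ≤ j := by
  simp [passKey, Prod.Lex.toLex_le_toLex]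

theorem integral_indicator_Ioi_mul {g G : ℝ → ℝ} (hG : ∀ t, HasDerivAt G (g t) t)
    (hg : Continuous g) {b M : ℝ} (h₁ : -M ≤ b) (h₂ : b ≤ M) :
    ∫ t in -M..M, (Set.Ioi b).indicator g t = G M - G b := by
  have hi : ∀ u v, IntervalIntegrable ((Set.Ioi b).indicator g) volume u v := fun u v => by
    rw [intervalIntegrable_iff]
    exact ((hg.intervalIntegrable u v).def').indicator measurableSet_Ioi
  rw [← intervalIntegral.integral_add_adjacent_intervals (hi (-M) b) (hi b M)]
  have e₁ : ∫ t in -M..b, (Set.Ioi b).indicator g t = 0 := by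
    rw [intervalIntegral.integral_of_le h₁]
    refine setIntegral_eq_zero_of_forall_eq_zero fun t ht => ?_
    exact Set.indicator_of_notMem (fun h => absurd ht.2 (not_le.2 h)) _
  have e₂ : ∫ t in b..M, (Set.Ioi b).indicator g t = ∫ t in b..M, g t := by
    rw [intervalIntegral.integral_of_le h₂, intervalIntegral.integral_of_le h₂]
    exact setIntegral_congr_fun measurableSet_Ioc fun t ht => Set.indicator_of_mem ht.1 _
  rw [e₁, e₂, intervalIntegral.integral_eq_sub_of_hasDerivAt (fun t _ => hG t)
    (hg.intervalIntegrable _ _), zero_add]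

/-- The fundamental theorem of calculus for a function whose factor
`t ↦ φ {i | β i + α i * t < 0}` is piecewise constant: only the jumps of this factor contribute.
Coinciding zeros are treated as if they were passed one after the other. -/
theorem integral_signPattern_mul {N : ℕ} {α β : ℕ → ℝ} {φ : Finset ℕ → ℝ} {g G : ℝ → ℝ}
    (hG : ∀ t, HasDerivAt G (g t) t) (hg : Continuous g)
    {lo hi : ℕ} (hlo : lo < N) (hlo' : 0 < α lo) (hφlo : ∀ T, lo ∈ T → φ T = 0)
    (hhi : hi < N) (hhi' : α hi < 0) (hφhi : ∀ T, hi ∈ T → φ T = 0) :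
    ∫ t, φ ((Finset.range N).filter fun i => β i + α i * t < 0) * g t =
      ∑ j ∈ (Finset.range N).filter (fun j => α j ≠ 0), G (-β j / α j) *
        (φ (passedNeg N α β (((Finset.range N).filter (fun j => α j ≠ 0)).filter
            (passKey α β · < passKey α β j))) -
          φ (passedNeg N α β (((Finset.range N).filter (fun j => α j ≠ 0)).filter
            (passKey α β · ≤ passKey α β j)))) := by
  -- `ψ U` is the value of the piecewise constant factor when exactly the zeros in `U` are passed,
  -- and `Δ j` is its jump at the zero `b j`.
  set J := (Finset.range N).filter (fun j => α j ≠ 0) with hJ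
  set b : ℕ → ℝ := fun j => -β j / α j with hb
  set ψ : Finset ℕ → ℝ := fun U => φ (passedNeg N α β U) with hψ
  set Δ : ℕ → ℝ := fun j => ψ (J.filter (passKey α β · ≤ passKey α β j)) -
    ψ (J.filter (passKey α β · < passKey α β j)) with hΔ
  obtain ⟨M, hM⟩ : ∃ M : ℝ, ∀ j ∈ J, |b j| ≤ M :=
    ⟨∑ j ∈ J, |b j|, fun j hj => Finset.single_le_sum (f := fun j => |b j|)
      (fun i _ => abs_nonneg _) hj⟩
  -- The rows `lo` and `hi` make the factor vanish near `-∞` and near `+∞`.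
  have hψ0 : ψ ∅ = 0 := hφlo _ (by simp [passedNeg, hlo, hlo'.ne', hlo'])
  have hψJ : ψ J = 0 := hφhi _ (by simp [passedNeg, hhi, hhi'.ne, hhi', hJ])
  have hpass : ∀ t, (∀ j ∈ J, t ≠ b j) →
      φ ((Finset.range N).filter fun i => β i + α i * t < 0) = ψ (J.filter (b · < t)) := by
    intro t ht
    simp only [hψ, passedNeg]
    congr 1
    refine Finset.filter_congr fun i hi => ?_
    by_cases h0 : α i = 0
    · simp [h0]
    have hiJ : i ∈ J := Finset.mem_filter.2 ⟨hi, h0⟩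
    have hval : β i + α i * t = α i * (t - b i) := by
      simp only [hb]; field_simp; ring
    rw [if_neg h0, hval]
    simp only [Finset.mem_filter, hiJ, true_and]
    rcases lt_or_gt_of_ne (ht i hiJ) with h | h
    · rw [if_neg (not_lt.2 h.le)]
      constructor
      · intro h'
        by_contra h''
        have := mul_nonneg_of_nonpos_of_nonpos (not_lt.1 h'') (sub_nonpos.2 h.le)
        linarith
      · intro h'; exact mul_neg_of_pos_of_neg h' (sub_neg.2 h)
    · rw [if_pos h]
      constructor
      · intro h'
        by_contra h''
        have := mul_nonneg (not_lt.1 h'') (sub_nonneg.2 h.le)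
        linarith
      · intro h'; exact mul_neg_of_neg_of_pos h' (sub_pos.2 h)
  have hstep : ∀ t, ψ (J.filter (b · < t)) = ∑ j ∈ J, if b j < t then Δ j else 0 := by
    intro t
    have := sum_jumps_eq_sub (passKey_injective α β) ψ J (J.filter (b · < t))
      (Finset.filter_subset _ _) (by
        intro i hi x hx hxi
        simp only [Finset.mem_filter] at hi ⊢
        refine ⟨hx, lt_of_le_of_lt ?_ hi.2⟩
        rcases passKey_le.1 hxi with h | h
        · exact h.le
        · exact h.1.le)
    rw [hψ0, sub_zero] at this
    rw [← this, Finset.sum_filter]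
  have hsum : ∑ j ∈ J, Δ j = 0 := by
    have := sum_jumps_eq_sub (passKey_injective α β) ψ J J subset_rfl (fun _ _ x hx _ => hx)
    rw [hψ0, hψJ, sub_zero] at this
    exact this
  have hae : ∀ᵐ t : ℝ, ∀ j ∈ J, t ≠ b j := by
    have : ∀ᵐ t : ℝ, t ∉ (J.image b : Set ℝ) :=
      measure_eq_zero_iff_ae_notMem.1 ((J.image b).finite_toSet.measure_zero volume)
    filter_upwards [this] with t ht j hj h
    exact ht (by simpa using ⟨j, hj, h.symm⟩)
  have hzero : ∀ t, t ∉ Set.Ioc (-M) M → (∀ j ∈ J, t ≠ b j) →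
      ψ (J.filter (b · < t)) = 0 := by
    intro t ht hne
    rw [Set.mem_Ioc, not_and_or, not_lt, not_le] at ht
    rcases ht with h | h
    · rw [Finset.filter_false_of_mem, hψ0]
      intro j hj
      have := (abs_le.1 (hM j hj)).1
      linarith
    · rw [Finset.filter_true_of_mem, hψJ]
      intro j hj
      exact lt_of_le_of_lt ((le_abs_self _).trans (hM j hj)) h
  have hM0 : -M ≤ M := by
    have := (abs_nonneg _).trans (hM lo (Finset.mem_filter.2 ⟨Finset.mem_range.2 hlo, hlo'.ne'⟩))
    linarith
  have hii : ∀ j ∈ J, IntervalIntegrable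
      (fun t => Δ j * (Set.Ioi (b j)).indicator g t) volume (-M) M := fun j _ => by
    refine IntervalIntegrable.const_mul ?_ _
    rw [intervalIntegrable_iff]
    exact ((hg.intervalIntegrable _ _).def').indicator measurableSet_Ioi
  calc ∫ t, φ ((Finset.range N).filter fun i => β i + α i * t < 0) * g t
      = ∫ t, (Set.Ioc (-M) M).indicator
          (fun t => ∑ j ∈ J, Δ j * (Set.Ioi (b j)).indicator g t) t := by
        refine integral_congr_ae ?_
        filter_upwards [hae] with t ht
        rw [hpass t ht]
        by_cases hmem : t ∈ Set.Ioc (-M) M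
        · rw [Set.indicator_of_mem hmem, hstep, Finset.sum_mul]
          refine Finset.sum_congr rfl fun j _ => ?_
          by_cases hj : b j < t
          · rw [if_pos hj, Set.indicator_of_mem (by exact hj)]
          · rw [if_neg hj, Set.indicator_of_notMem (by exact hj)]; simp
        · rw [Set.indicator_of_notMem hmem, hzero t hmem ht, zero_mul]
    _ = ∑ j ∈ J, Δ j * (G M - G (b j)) := by
        rw [integral_indicator measurableSet_Ioc, ← intervalIntegral.integral_of_le hM0,
          intervalIntegral.integral_finsetSum hii]
        refine Finset.sum_congr rfl fun j hj => ?_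
        have := abs_le.1 (hM j hj)
        rw [intervalIntegral.integral_const_mul,
          integral_indicator_Ioi_mul hG hg this.1 this.2]
    _ = (∑ j ∈ J, Δ j) * G M + ∑ j ∈ J, G (b j) * -Δ j := by
        rw [Finset.sum_mul, ← Finset.sum_add_distrib]
        exact Finset.sum_congr rfl fun j _ => by ring
    _ = _ := by
        rw [hsum, zero_mul, zero_add]
        exact Finset.sum_congr rfl fun j _ => by simp [hΔ, hψ, hb]

/-! ### The elimination formula for integrals over arrangements of hyperplanes -/

/-- The affine function on `ℝ^k` with constant term `r 0` and coefficient `r (l + 1)` at the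
coordinate `l`. -/
noncomputable def affEval (k : ℕ) (r : ℕ → ℝ) (y : Fin k → ℝ) : ℝ :=
  r 0 + ∑ l : Fin k, r (l + 1) * y l

theorem affEval_snoc (k : ℕ) (r : ℕ → ℝ) (y : Fin k → ℝ) (t : ℝ) :
    affEval (k + 1) r (Fin.snoc (α := fun _ => ℝ) y t) = affEval k r y + r (k + 1) * t := by
  simp [affEval, Fin.sum_univ_castSucc, add_assoc]

theorem affEval_sub_mul (k : ℕ) (r p : ℕ → ℝ) (q : ℝ) (y : Fin k → ℝ) :
    affEval k (fun l => r l - q * p l) y = affEval k r y - q * affEval k p y := by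
  simp only [affEval, mul_add, Finset.mul_sum, sub_mul, Finset.sum_sub_distrib, mul_assoc]
  ring

theorem continuous_affEval (k : ℕ) (r : ℕ → ℝ) : Continuous (affEval k r) := by
  unfold affEval; fun_prop

/-- A nonzero affine function vanishes only on a null set. -/
theorem ae_affEval_ne_zero {k : ℕ} {r : ℕ → ℝ} (h : ∃ l ≤ k, r l ≠ 0) :
    ∀ᵐ y : Fin k → ℝ, affEval k r y ≠ 0 := by
  by_cases hc : ∀ l : Fin k, r (l + 1) = 0
  · obtain ⟨l, hl, hr⟩ := h
    have h0 : r 0 ≠ 0 := by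
      rcases l with _ | l
      · exact hr
      · exact absurd (hc ⟨l, hl⟩) hr
    exact Filter.Eventually.of_forall fun y => by simp [affEval, hc, h0]
  push Not at hc
  obtain ⟨l, hl⟩ := hc
  let f : (Fin k → ℝ) →ₗ[ℝ] ℝ := ∑ l : Fin k, r (l + 1) • LinearMap.proj l
  have hf : ∀ y, affEval k r y = r 0 + f y := fun y => by simp [affEval, f]
  have hf1 : f (Pi.single l 1) = r (l + 1) := by simp [f, Pi.single_apply]
  let p : Fin k → ℝ := Pi.single l (-r 0 / r (l + 1))
  have hp : f p = - r 0 := by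
    have : p = (-r 0 / r (l + 1)) • Pi.single l (1 : ℝ) := by
      ext i; simp [p, Pi.single_apply]
    rw [this, map_smul, hf1, smul_eq_mul]; field_simp
  have hne : AffineSubspace.mk' p (LinearMap.ker f) ≠ ⊤ := by
    intro h
    have : p + Pi.single l 1 ∈ AffineSubspace.mk' p (LinearMap.ker f) :=
      h ▸ AffineSubspace.mem_top _ _ _
    simp [AffineSubspace.mem_mk', hf1, hl] at this
  have := measure_eq_zero_iff_ae_notMem.1 (Measure.addHaar_affineSubspace volume _ hne)
  filter_upwards [this] with y hy h0
  apply hy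
  simp only [SetLike.mem_coe, AffineSubspace.mem_mk', vsub_eq_sub, LinearMap.mem_ker, map_sub, hp]
  rw [hf] at h0; linarith

/-- The indices `i < N` of the rows of `R` that are negative at `y`. -/
noncomputable def negSet (N k : ℕ) (R : ℕ → ℕ → ℝ) (y : Fin k → ℝ) : Finset ℕ :=
  (Finset.range N).filter fun i => affEval k (R i) y < 0

/-- Eliminates the coordinate `k` from the rows of `R` by means of the pivot row `j`, that is,
restricts all rows to the hyperplane on which row `j` vanishes. A row `i < N` that vanishes
identically on this hyperplane is replaced by a constant whose sign is that of row `i` when the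
zeros of the rows `< j + a` have been passed in direction of the coordinate `k`, and those of the
other rows have not. -/
noncomputable def reduceRows (N k j a : ℕ) (R : ℕ → ℕ → ℝ) (i l : ℕ) : ℝ :=
  if i < N ∧ R i (k + 1) ≠ 0 ∧ ∀ m ≤ k, R i m - R i (k + 1) / R j (k + 1) * R j m = 0 then
    if l = 0 then (if i < j + a then R i (k + 1) else -R i (k + 1)) else 0
  else R i l - R i (k + 1) / R j (k + 1) * R j l

/-- The weight with which the hyperplane of the pivot row `j` enters the formula for the integral;
it vanishes if row `j` does not depend on the coordinate `k`, because then the factor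
`R j (k + 1) / R j (k + 1)` is `0 / 0 = 0`. -/
noncomputable def pivotWeight (N k j a : ℕ) (R : ℕ → ℕ → ℝ) : ℝ :=
  (1 - 2 * (a : ℝ)) * (R j (k + 1) / R j (k + 1)) / R N (k + 1)

/-- The contribution to the integral of the flag of hyperplanes selected by the digits `D`: the
digit `D k < 2 * N` encodes the pivot row and the side for the elimination of coordinate `k`. The
integer `m` is the degree reached by the repeated antiderivatives of the powers of row `N`. -/
noncomputable def flagTerm (N : ℕ) (φ : Finset ℕ → ℝ) (D : ℕ → ℕ) :
    ℕ → ℕ → (ℕ → ℕ → ℝ) → ℝ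
  | 0, m, R => φ ((Finset.range N).filter fun i => R i 0 < 0) * (R N 0 ^ m / (m.factorial : ℝ))
  | k + 1, m, R =>
    pivotWeight N k (if D k < N then D k else D k - N) (if D k < N then 0 else 1) R *
      flagTerm N φ D k (m + 1)
        (reduceRows N k (if D k < N then D k else D k - N) (if D k < N then 0 else 1) R)

theorem flagTerm_congr {N : ℕ} {φ : Finset ℕ → ℝ} {D D' : ℕ → ℕ} {k : ℕ}
    (h : ∀ l < k, D l = D' l) (m : ℕ) (R : ℕ → ℕ → ℝ) :
    flagTerm N φ D k m R = flagTerm N φ D' k m R := by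
  induction k generalizing m R with
  | zero => rfl
  | succ k ih =>
    simp only [flagTerm, h k (Nat.lt_succ_self k)]
    rw [ih fun l hl => h l (Nat.lt_succ_of_lt hl)]

/-- The hypotheses under which the elimination formula holds. The coordinate part of each of the
rows `i < N` is a multiple of `± e_a` or of `± e_a ± e_b`, the coefficients of row `N` have
different 2-adic valuations, and `φ` vanishes outside of the unit cube, whose facets occur among
the rows. -/
structure Admissible (N k : ℕ) (φ : Finset ℕ → ℝ) (R : ℕ → ℕ → ℝ) : Prop where
  sparse : ∀ i < N, ∀ l₁ l₂ l₃, l₁ < l₂ → l₂ < l₃ → l₃ < k →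
    R i (l₁ + 1) = 0 ∨ R i (l₂ + 1) = 0 ∨ R i (l₃ + 1) = 0
  ratio : ∀ i < N, ∀ l₁ l₂, l₁ < l₂ → l₂ < k →
    R i (l₁ + 1) = 0 ∨ R i (l₂ + 1) = 0 ∨ R i (l₁ + 1) = R i (l₂ + 1) ∨
      R i (l₁ + 1) = -R i (l₂ + 1)
  objective : ∀ l < k, ∃ z : ℤ, R N (l + 1) = 2 ^ (l + 1) * (2 * z + 1)
  lower : ∀ l < k, ∃ i < N, (∀ T, i ∈ T → φ T = 0) ∧ R i = fun m => if m = l + 1 then 1 else 0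
  upper : ∀ l < k, ∃ i < N, (∀ T, i ∈ T → φ T = 0) ∧
    R i = fun m => if m = 0 then 1 else if m = l + 1 then -1 else 0

theorem reduceRows_objective (N k j a : ℕ) (R : ℕ → ℕ → ℝ) (l : ℕ) :
    reduceRows N k j a R N l = R N l - R N (k + 1) / R j (k + 1) * R j l := by
  simp [reduceRows]

theorem reduceRows_of_eq_zero {N k j a : ℕ} {R : ℕ → ℕ → ℝ} {i : ℕ} (h : R i (k + 1) = 0) :
    reduceRows N k j a R i = R i := by
  ext l; simp [reduceRows, h]

/-- The linear form of row `N` is not constant along any coordinate axis, so that its powers have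
antiderivatives that are powers again. -/
theorem Admissible.objective_ne_zero {N k : ℕ} {φ : Finset ℕ → ℝ} {R : ℕ → ℕ → ℝ}
    (h : Admissible N k φ R) {l : ℕ} (hl : l < k) : R N (l + 1) ≠ 0 := by
  obtain ⟨z, hz⟩ := h.objective l hl
  rw [hz]
  have : (2 * z + 1 : ℤ) ≠ 0 := by omega
  have : (2 * (z : ℝ) + 1) ≠ 0 := by exact_mod_cast this
  positivity

/-- If two vectors with at most one nonzero entry each have their entries in `{0, α, -α}`, then the
nonzero entries of their difference agree up to sign. -/
theorem ratio_sub {x₁ x₂ y₁ y₂ α : ℝ} (hx : x₁ = 0 ∨ x₂ = 0) (hy : y₁ = 0 ∨ y₂ = 0)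
    (hx₁ : x₁ = 0 ∨ x₁ = α ∨ x₁ = -α) (hx₂ : x₂ = 0 ∨ x₂ = α ∨ x₂ = -α)
    (hy₁ : y₁ = 0 ∨ y₁ = α ∨ y₁ = -α) (hy₂ : y₂ = 0 ∨ y₂ = α ∨ y₂ = -α) :
    x₁ - y₁ = 0 ∨ x₂ - y₂ = 0 ∨ x₁ - y₁ = x₂ - y₂ ∨ x₁ - y₁ = -(x₂ - y₂) := by
  rcases hx with rfl | rfl <;> rcases hy with rfl | rfl
  · simp
  · rcases hx₂ with rfl | rfl | rfl <;> rcases hy₁ with rfl | rfl | rfl <;> simp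
  · rcases hx₁ with rfl | rfl | rfl <;> rcases hy₂ with rfl | rfl | rfl <;> simp
  · simp

/-- Admissibility is preserved by elimination. Rows that contain the coordinate `k` have at most one
further nonzero coefficient, so that eliminating `k` leaves at most two of them. The coefficient of
row `N` at `l` changes by an integer multiple of its coefficient at `k > l`, which is divisible by a
higher power of `2`. The facets of the cube orthogonal to other coordinates are not affected. -/
theorem Admissible.reduceRows_pivot {N k : ℕ} {φ : Finset ℕ → ℝ} {R : ℕ → ℕ → ℝ}
    (h : Admissible N (k + 1) φ R) {j : ℕ} (hj : j < N) (hα : R j (k + 1) ≠ 0) (a : ℕ) :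
    Admissible N k φ (reduceRows N k j a R) := by
  have key : ∀ i < N, (reduceRows N k j a R i = R i) ∨ (∀ l, reduceRows N k j a R i (l + 1) = 0) ∨
      (R i (k + 1) ≠ 0 ∧
        ∀ l, reduceRows N k j a R i l = R i l - R i (k + 1) / R j (k + 1) * R j l) := by
    intro i hi
    by_cases h0 : R i (k + 1) = 0
    · exact Or.inl (reduceRows_of_eq_zero h0)
    · right
      by_cases h1 : i < N ∧ R i (k + 1) ≠ 0 ∧
          ∀ m ≤ k, R i m - R i (k + 1) / R j (k + 1) * R j m = 0
      · left; intro l; simp only [reduceRows, if_pos h1]; simp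
      · right; exact ⟨h0, fun l => by simp only [reduceRows, if_neg h1]⟩
  have one : ∀ i < N, R i (k + 1) ≠ 0 → ∀ l₁ l₂, l₁ < l₂ → l₂ < k →
      R i (l₁ + 1) = 0 ∨ R i (l₂ + 1) = 0 := by
    intro i hi h0 l₁ l₂ h₁ h₂
    rcases h.sparse i hi l₁ l₂ k h₁ h₂ (Nat.lt_succ_self k) with h | h | h
    · exact Or.inl h
    · exact Or.inr h
    · exact absurd h h0
  have rat : ∀ i < N, R i (k + 1) ≠ 0 → ∀ l < k, R i (l + 1) = 0 ∨ R i (l + 1) = R i (k + 1) ∨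
      R i (l + 1) = -R i (k + 1) := by
    intro i hi h0 l hl
    rcases h.ratio i hi l k hl (Nat.lt_succ_self k) with h | h | h | h
    · exact Or.inl h
    · exact absurd h h0
    · exact Or.inr (Or.inl h)
    · exact Or.inr (Or.inr h)
  refine ⟨?_, ?_, ?_, ?_, ?_⟩
  · intro i hi l₁ l₂ l₃ h₁ h₂ h₃
    rcases key i hi with e | e | ⟨h0, e⟩
    · rw [e]; exact h.sparse i hi l₁ l₂ l₃ h₁ h₂ (by omega)
    · exact Or.inl (e _)
    · simp only [e]
      have a1 := one i hi h0 l₁ l₂ h₁ (by omega)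
      have a2 := one i hi h0 l₁ l₃ (by omega) (by omega)
      have a3 := one i hi h0 l₂ l₃ h₂ (by omega)
      have b1 := one j hj hα l₁ l₂ h₁ (by omega)
      have b2 := one j hj hα l₁ l₃ (by omega) (by omega)
      have b3 := one j hj hα l₂ l₃ h₂ (by omega)
      grind
  · intro i hi l₁ l₂ h₁ h₂
    rcases key i hi with e | e | ⟨h0, e⟩
    · rw [e]; exact h.ratio i hi l₁ l₂ h₁ (by omega)
    · exact Or.inl (e _)
    · simp only [e]
      have a1 := one i hi h0 l₁ l₂ h₁ (by omega)
      have b1 := one j hj hα l₁ l₂ h₁ (by omega)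
      have a2 := rat i hi h0 l₁ (by omega)
      have a3 := rat i hi h0 l₂ (by omega)
      have b2 := rat j hj hα l₁ (by omega)
      have b3 := rat j hj hα l₂ (by omega)
      have hq : R i (k + 1) / R j (k + 1) * R j (k + 1) = R i (k + 1) := by field_simp
      have c : ∀ x, x = 0 ∨ x = R j (k + 1) ∨ x = -R j (k + 1) →
          R i (k + 1) / R j (k + 1) * x = 0 ∨ R i (k + 1) / R j (k + 1) * x = R i (k + 1) ∨
            R i (k + 1) / R j (k + 1) * x = -R i (k + 1) := by
        rintro x (rfl | rfl | rfl)
        · simp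
        · exact Or.inr (Or.inl hq)
        · exact Or.inr (Or.inr (by rw [mul_neg, hq]))
      have c2 := c _ b2
      have c3 := c _ b3
      have d1 : R i (k + 1) / R j (k + 1) * R j (l₁ + 1) = 0 ∨
          R i (k + 1) / R j (k + 1) * R j (l₂ + 1) = 0 := by
        rcases b1 with h | h <;> simp [h]
      exact ratio_sub a1 d1 a2 a3 c2 c3
  · intro l hl
    obtain ⟨z, hz⟩ := h.objective l (by omega)
    obtain ⟨w, hw⟩ := h.objective k (by omega)
    have : ∃ u : ℤ, R j (l + 1) / R j (k + 1) = u := by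
      rcases rat j hj hα l hl with h | h | h
      · exact ⟨0, by simp [h]⟩
      · exact ⟨1, by simp [h, hα]⟩
      · exact ⟨-1, by simp [h, hα]⟩
    obtain ⟨u, hu⟩ := this
    obtain ⟨e, rfl⟩ : ∃ e, k = l + 1 + e := ⟨k - (l + 1), by omega⟩
    refine ⟨z - 2 ^ e * (2 * w + 1) * u, ?_⟩
    rw [reduceRows_objective, hz, show R N (l + 1 + e + 1) / R j (l + 1 + e + 1) * R j (l + 1) =
      R N (l + 1 + e + 1) * (R j (l + 1) / R j (l + 1 + e + 1)) by ring, hu, hw]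
    push_cast
    ring
  · intro l hl
    obtain ⟨i, hi, hφ, hR⟩ := h.lower l (by omega)
    refine ⟨i, hi, hφ, ?_⟩
    rw [reduceRows_of_eq_zero, hR]
    simp [hR]; omega
  · intro l hl
    obtain ⟨i, hi, hφ, hR⟩ := h.upper l (by omega)
    refine ⟨i, hi, hφ, ?_⟩
    rw [reduceRows_of_eq_zero, hR]
    simp [hR]; omega

theorem measurable_negSet (N k : ℕ) (R : ℕ → ℕ → ℝ) : Measurable[_, ⊤] (negSet N k R) := by
  let _ : MeasurableSpace (Finset ℕ) := ⊤
  refine measurable_to_countable' fun T => ?_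
  by_cases hT : T ⊆ Finset.range N
  · have : negSet N k R ⁻¹' {T} =
        ⋂ i ∈ Finset.range N, {y | affEval k (R i) y < 0 ↔ i ∈ T} := by
      ext y
      simp only [Set.mem_preimage, Set.mem_singleton_iff, Set.mem_iInter, Set.mem_ofPred_eq, negSet,
        Finset.ext_iff, Finset.mem_filter]
      constructor
      · intro h i hi
        rw [← h i]
        exact ⟨fun h' => ⟨hi, h'⟩, fun h' => h'.2⟩
      · intro h i
        constructor
        · intro hi; exact (h i hi.1).1 hi.2
        · intro hi; exact ⟨hT hi, (h i (hT hi)).2 hi⟩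
    rw [this]
    refine Finset.measurableSet_biInter _ fun i _ => ?_
    by_cases hi : i ∈ T
    · simp only [hi, iff_true]
      exact measurableSet_lt (continuous_affEval k (R i)).measurable measurable_const
    · simp only [hi, iff_false, not_lt]
      exact measurableSet_le measurable_const (continuous_affEval k (R i)).measurable
  · have : negSet N k R ⁻¹' {T} = ∅ := by
      ext y
      simp only [Set.mem_preimage, Set.mem_singleton_iff, Set.mem_empty_iff_false, iff_false]
      rintro rfl
      exact hT (Finset.filter_subset _ _)
    rw [this]
    exact MeasurableSet.empty

theorem Admissible.eq_zero_of_notMem {N k : ℕ} {φ : Finset ℕ → ℝ} {R : ℕ → ℕ → ℝ}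
    (h : Admissible N k φ R) {y : Fin k → ℝ} (hy : y ∉ Set.Icc 0 1) :
    φ (negSet N k R y) = 0 := by
  simp only [Set.mem_Icc, Pi.le_def, not_and_or, not_forall, not_le] at hy
  rcases hy with ⟨l, hl⟩ | ⟨l, hl⟩
  · obtain ⟨i, hi, hφ, hR⟩ := h.lower l l.2
    refine hφ _ (Finset.mem_filter.2 ⟨Finset.mem_range.2 hi, ?_⟩)
    have : affEval k (R i) y = y l := by
      simp [hR, affEval, Fin.val_inj]
    rw [this]; exact hl
  · obtain ⟨i, hi, hφ, hR⟩ := h.upper l l.2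
    refine hφ _ (Finset.mem_filter.2 ⟨Finset.mem_range.2 hi, ?_⟩)
    have : affEval k (R i) y = 1 - y l := by
      simp [hR, affEval, Fin.val_inj, ite_mul, sub_eq_add_neg]
    rw [this]; simp at hl; linarith

theorem Admissible.integrable {N k : ℕ} {φ : Finset ℕ → ℝ} {R : ℕ → ℕ → ℝ}
    (h : Admissible N k φ R) {g : (Fin k → ℝ) → ℝ} (hg : Continuous g) :
    Integrable fun y => φ (negSet N k R y) * g y := by
  refine IntegrableOn.integrable_of_forall_notMem_eq_zero (s := Set.Icc 0 1) ?_
    fun y hy => by rw [h.eq_zero_of_notMem hy, zero_mul]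
  refine Integrable.bdd_mul (c := ∑ T ∈ (Finset.range N).powerset, |φ T|)
    (hg.continuousOn.integrableOn_compact isCompact_Icc) ?_ ?_
  · exact (Measurable.comp (g := φ) (f := negSet N k R) measurable_from_top
      (measurable_negSet N k R)).aestronglyMeasurable
  · refine Filter.Eventually.of_forall fun y => ?_
    exact Finset.single_le_sum (f := fun T => |φ T|) (fun _ _ => abs_nonneg _)
      (Finset.mem_powerset.2 (Finset.filter_subset _ _))

theorem affEval_const (k : ℕ) (c : ℝ) (y : Fin k → ℝ) :
    affEval k (fun l => if l = 0 then c else 0) y = c := by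
  simp [affEval]

/-- For almost all points of the hyperplane of row `j`, the signs of the reduced rows are the signs
of the original rows just before (`a = 0`) or just after (`a = 1`) row `j` changes its sign. -/
theorem negSet_reduceRows {N k : ℕ} {R : ℕ → ℕ → ℝ} {y : Fin k → ℝ} {j : ℕ}
    (hα : R j (k + 1) ≠ 0)
    (hy : ∀ i < N, (∀ m ≤ k, R i m - R i (k + 1) / R j (k + 1) * R j m = 0) ∨
      affEval k (fun l => R i l - R i (k + 1) / R j (k + 1) * R j l) y ≠ 0)
    (a : ℕ) {p : ℕ → Prop} [DecidablePred p]
    (hp : ∀ i, p i ↔ -affEval k (R i) y / R i (k + 1) < -affEval k (R j) y / R j (k + 1) ∨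
      -affEval k (R i) y / R i (k + 1) = -affEval k (R j) y / R j (k + 1) ∧ i < j + a) :
    negSet N k (reduceRows N k j a R) y =
      passedNeg N (fun i => R i (k + 1)) (fun i => affEval k (R i) y)
        (((Finset.range N).filter (fun i => R i (k + 1) ≠ 0)).filter p) := by
  refine Finset.filter_congr fun i hi => ?_
  have hiN : i < N := Finset.mem_range.1 hi
  by_cases h0 : R i (k + 1) = 0
  · rw [reduceRows_of_eq_zero h0, if_pos h0]
  rw [if_neg h0]
  simp only [Finset.mem_filter, hi, h0, ne_eq, not_false_eq_true, true_and, hp]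
  have hval : affEval k (fun l => R i l - R i (k + 1) / R j (k + 1) * R j l) y =
      R i (k + 1) * (-affEval k (R j) y / R j (k + 1) - -affEval k (R i) y / R i (k + 1)) := by
    rw [affEval_sub_mul]; field_simp; ring
  by_cases h1 : ∀ m ≤ k, R i m - R i (k + 1) / R j (k + 1) * R j m = 0
  · have e : reduceRows N k j a R i =
        fun l => if l = 0 then (if i < j + a then R i (k + 1) else -R i (k + 1)) else 0 := by
      ext l; simp only [reduceRows, if_pos (And.intro hiN (And.intro h0 h1))]
    rw [e, affEval_const]
    have hz : affEval k (fun l => R i l - R i (k + 1) / R j (k + 1) * R j l) y = 0 := by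
      simp only [affEval, h1 0 (Nat.zero_le k), zero_add]
      exact Finset.sum_eq_zero fun l _ => by rw [h1 _ l.2, zero_mul]
    rw [hval] at hz
    have hz' := (sub_eq_zero.1 ((mul_eq_zero.1 hz).resolve_left h0))
    simp only [hz', lt_irrefl, true_and, false_or]
    split_ifs <;> simp
  · have e : reduceRows N k j a R i =
        fun l => R i l - R i (k + 1) / R j (k + 1) * R j l := by
      ext l; simp only [reduceRows, h1, and_false, if_false]
    have hne := (hy i hiN).resolve_left h1
    rw [e, hval]
    rw [hval] at hne
    have hne' := sub_ne_zero.1 (right_ne_zero_of_mul hne)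
    rcases lt_or_gt_of_ne hne' with h | h
    · rw [if_neg (by intro h'; rcases h' with h' | h'; exacts [lt_asymm h h', h.ne' h'.1])]
      have := sub_neg.2 h
      constructor
      · intro h'
        by_contra h''
        exact absurd h' (not_lt.2 (mul_nonneg_of_nonpos_of_nonpos (not_lt.1 h'') this.le))
      · intro h'; exact mul_neg_of_pos_of_neg h' this
    · rw [if_pos (Or.inl h)]
      have := sub_pos.2 h
      constructor
      · intro h'
        by_contra h''
        exact absurd h' (not_lt.2 (mul_nonneg (not_lt.1 h'') this.le))
      · intro h'; exact mul_neg_of_neg_of_pos h' this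

/-- Integrating out the last coordinate, over a point `y` above which different hyperplanes do not
meet. -/
theorem Admissible.integral_snoc {N k : ℕ} {φ : Finset ℕ → ℝ} {R : ℕ → ℕ → ℝ}
    (h : Admissible N (k + 1) φ R) (m : ℕ) {y : Fin k → ℝ}
    (hy : ∀ j < N, ∀ i < N, (∀ m ≤ k, R i m - R i (k + 1) / R j (k + 1) * R j m = 0) ∨
      affEval k (fun l => R i l - R i (k + 1) / R j (k + 1) * R j l) y ≠ 0) :
    ∫ t, φ (negSet N (k + 1) R (Fin.snoc (α := fun _ => ℝ) y t)) *
        (affEval (k + 1) (R N) (Fin.snoc (α := fun _ => ℝ) y t) ^ m / (m.factorial : ℝ)) =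
      ∑ a ∈ Finset.range 2, ∑ j ∈ Finset.range N, pivotWeight N k j a R *
        (φ (negSet N k (reduceRows N k j a R) y) *
          (affEval k (reduceRows N k j a R N) y ^ (m + 1) / ((m + 1).factorial : ℝ))) := by
  obtain ⟨lo, hlo, hφlo, hRlo⟩ := h.lower k (Nat.lt_succ_self k)
  obtain ⟨hi, hhi, hφhi, hRhi⟩ := h.upper k (Nat.lt_succ_self k)
  have hc : R N (k + 1) ≠ 0 := h.objective_ne_zero (Nat.lt_succ_self k)
  set γ := affEval k (R N) y with hγ
  set c := R N (k + 1) with hcdef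
  simp only [negSet, affEval_snoc]
  -- Dividing by `c` is possible because row `N` depends on the coordinate `k`.
  have hG : ∀ t, HasDerivAt (fun t => (γ + c * t) ^ (m + 1) / ((m + 1).factorial : ℝ) / c)
      ((γ + c * t) ^ m / (m.factorial : ℝ)) t := by
    intro t
    have h1 : HasDerivAt (fun t => γ + c * t) c t := by
      simpa using ((hasDerivAt_id t).const_mul c).const_add γ
    have h2 := ((h1.pow (m + 1)).div_const ((m + 1).factorial : ℝ)).div_const c
    refine h2.congr_deriv ?_
    have h3 : (m.factorial : ℝ) ≠ 0 := by positivity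
    have h4 : (m : ℝ) + 1 ≠ 0 := by positivity
    rw [Nat.factorial_succ, Nat.add_sub_cancel]
    push_cast
    field_simp
  rw [integral_signPattern_mul (α := fun i => R i (k + 1)) (β := fun i => affEval k (R i) y) hG
    (by fun_prop) hlo (by simp [hRlo]) hφlo hhi (by simp [hRhi]) hφhi, Finset.sum_comm,
    Finset.sum_filter]
  refine Finset.sum_congr rfl fun j hj => ?_
  by_cases hα : R j (k + 1) = 0
  · simp [hα, pivotWeight]
  have hobj : ∀ a, affEval k (reduceRows N k j a R N) y =
      γ + c * (-affEval k (R j) y / R j (k + 1)) := by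
    intro a
    rw [show reduceRows N k j a R N = fun l => R N l - R N (k + 1) / R j (k + 1) * R j l from
      funext (reduceRows_objective N k j a R), affEval_sub_mul]
    ring
  have h0 := negSet_reduceRows hα (hy j (Finset.mem_range.1 hj)) 0
    (p := fun i => passKey (fun i => R i (k + 1)) (fun i => affEval k (R i) y) i <
      passKey (fun i => R i (k + 1)) (fun i => affEval k (R i) y) j)
    (fun i => passKey_lt)
  have h1 := negSet_reduceRows hα (hy j (Finset.mem_range.1 hj)) 1
    (p := fun i => passKey (fun i => R i (k + 1)) (fun i => affEval k (R i) y) i ≤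
      passKey (fun i => R i (k + 1)) (fun i => affEval k (R i) y) j)
    (fun i => by rw [passKey_le, Nat.lt_succ_iff])
  simp only [negSet] at h0 h1
  rw [if_pos hα, Finset.sum_range_succ, Finset.sum_range_one]
  simp only [hobj, h0, h1, pivotWeight, div_self hα]
  push_cast
  ring

theorem sum_range_mul_eq {M : Type*} [AddCommMonoid M] (n b : ℕ) (f : ℕ → M) :
    ∑ x ∈ Finset.range (n * b), f x =
      ∑ D ∈ Finset.range n, ∑ q ∈ Finset.range b, f (D * b + q) := by
  induction n with
  | zero => simp
  | succ n ih => rw [Nat.succ_mul, Finset.sum_range_add, ih, Finset.sum_range_succ]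

theorem integral_fin_succ {k : ℕ} {F : (Fin (k + 1) → ℝ) → ℝ} (hF : Integrable F) :
    ∫ y, F y = ∫ y : Fin k → ℝ, ∫ t, F (Fin.snoc (α := fun _ => ℝ) y t) := by
  have e := (volume_preserving_piFinSuccAbove (fun _ : Fin (k + 1) => ℝ) (Fin.last k)).symm
  rw [← e.integral_comp', Measure.volume_eq_prod, integral_prod_symm]
  · simp only [MeasurableEquiv.piFinSuccAbove_symm_apply, Fin.insertNthEquiv, Equiv.coe_fn_mk,
      Fin.insertNth_last']
  · exact (e.integrable_comp_emb (MeasurableEquiv.measurableEmbedding _)).2 hF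

/-- The sum over all digit vectors of length `k + 1`, split according to the top digit. -/
theorem sum_digits_succ {N : ℕ} (hN : 0 < N) (φ : Finset ℕ → ℝ) (k m : ℕ) (R : ℕ → ℕ → ℝ) :
    ∑ x ∈ Finset.range ((N + N) ^ (k + 1)),
        flagTerm N φ (fun l => x / (N + N) ^ l % (N + N)) (k + 1) m R =
      ∑ a ∈ Finset.range 2, ∑ j ∈ Finset.range N, pivotWeight N k j a R *
        ∑ x ∈ Finset.range ((N + N) ^ k), flagTerm N φ (fun l => x / (N + N) ^ l % (N + N)) k
          (m + 1) (reduceRows N k j a R) := by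
  have hB : 0 < (N + N) ^ k := by positivity
  have htop : ∀ D < N + N, ∀ q < (N + N) ^ k,
      (D * (N + N) ^ k + q) / (N + N) ^ k % (N + N) = D := by
    intro D hD q hq
    rw [mul_comm, Nat.mul_add_div hB, Nat.div_eq_of_lt hq, add_zero, Nat.mod_eq_of_lt hD]
  have hlow : ∀ D q, ∀ l < k,
      (D * (N + N) ^ k + q) / (N + N) ^ l % (N + N) = q / (N + N) ^ l % (N + N) := by
    intro D q l hl
    obtain ⟨e, rfl⟩ : ∃ e, k = l + 1 + e := ⟨k - (l + 1), by omega⟩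
    have : D * (N + N) ^ (l + 1 + e) = (N + N) ^ l * ((N + N) * (D * (N + N) ^ e)) := by ring
    rw [this, Nat.mul_add_div (by positivity), Nat.mul_add_mod]
  have hterm : ∀ D < N + N, ∑ q ∈ Finset.range ((N + N) ^ k),
      flagTerm N φ (fun l => (D * (N + N) ^ k + q) / (N + N) ^ l % (N + N)) (k + 1) m R =
      pivotWeight N k (if D < N then D else D - N) (if D < N then 0 else 1) R *
        ∑ x ∈ Finset.range ((N + N) ^ k), flagTerm N φ (fun l => x / (N + N) ^ l % (N + N)) k
          (m + 1) (reduceRows N k (if D < N then D else D - N) (if D < N then 0 else 1) R) := by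
    intro D hD
    rw [Finset.mul_sum]
    refine Finset.sum_congr rfl fun q hq => ?_
    simp only [flagTerm, htop D hD q (Finset.mem_range.1 hq)]
    rw [flagTerm_congr (hlow D q)]
  rw [pow_succ', sum_range_mul_eq, Finset.sum_congr rfl fun D hD => hterm D (Finset.mem_range.1 hD),
    Finset.sum_range_add, Finset.sum_range_succ, Finset.sum_range_one]
  congr 1
  · refine Finset.sum_congr rfl fun D hD => ?_
    simp only [if_pos (Finset.mem_range.1 hD)]
  · refine Finset.sum_congr rfl fun D hD => ?_
    simp

/-- The integral of a piecewise polynomial function over an arrangement of hyperplanes as a sum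
over the flags that its hyperplanes span. -/
theorem Admissible.integral_eq_sum {N k : ℕ} {φ : Finset ℕ → ℝ} {R : ℕ → ℕ → ℝ}
    (h : Admissible N k φ R) (m : ℕ) :
    ∫ y, φ (negSet N k R y) * (affEval k (R N) y ^ m / (m.factorial : ℝ)) =
      ∑ x ∈ Finset.range ((N + N) ^ k),
        flagTerm N φ (fun l => x / (N + N) ^ l % (N + N)) k m R := by
  induction k generalizing m R with
  | zero =>
    rw [integral_unique]
    simp [flagTerm, negSet, affEval, Measure.real, volume_pi]
  | succ k ih =>
    have hN : 0 < N := by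
      obtain ⟨i, hi, -⟩ := h.lower 0 (Nat.succ_pos k)
      omega
    have hpoly : ∀ {k} (r : ℕ → ℝ) (m : ℕ),
        Continuous fun y => affEval k r y ^ m / (m.factorial : ℝ) := fun r m =>
      ((continuous_affEval _ r).pow m).div_const _
    have hgen : ∀ᵐ y : Fin k → ℝ, ∀ j < N, ∀ i < N,
        (∀ m ≤ k, R i m - R i (k + 1) / R j (k + 1) * R j m = 0) ∨
          affEval k (fun l => R i l - R i (k + 1) / R j (k + 1) * R j l) y ≠ 0 := by
      simp only [ae_all_iff]
      intro j _ i _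
      by_cases h0 : ∀ m ≤ k, R i m - R i (k + 1) / R j (k + 1) * R j m = 0
      · exact Filter.Eventually.of_forall fun _ => Or.inl h0
      · push Not at h0
        filter_upwards [ae_affEval_ne_zero h0] with y hy
        exact Or.inr hy
    rw [integral_fin_succ (h.integrable (hpoly _ _)), sum_digits_succ hN,
      integral_congr_ae (hgen.mono fun y hy => h.integral_snoc m hy)]
    have hint : ∀ a, ∀ j ∈ Finset.range N, Integrable fun y : Fin k → ℝ =>
        pivotWeight N k j a R * (φ (negSet N k (reduceRows N k j a R) y) *
          (affEval k (reduceRows N k j a R N) y ^ (m + 1) / ((m + 1).factorial : ℝ))) := by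
      intro a j hj
      by_cases hα : R j (k + 1) = 0
      · simp [pivotWeight, hα]
      · exact ((h.reduceRows_pivot (Finset.mem_range.1 hj) hα a).integrable
          (hpoly _ _)).const_mul _
    rw [integral_finsetSum _ fun a _ => integrable_finsetSum _ (hint a)]
    refine Finset.sum_congr rfl fun a _ => ?_
    rw [integral_finsetSum _ (hint a)]
    refine Finset.sum_congr rfl fun j hj => ?_
    rw [integral_const_mul]
    by_cases hα : R j (k + 1) = 0
    · simp [pivotWeight, hα]
    · rw [ih (h.reduceRows_pivot (Finset.mem_range.1 hj) hα a)]

/-! ### The arrangement of a search space -/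

open RealRAM

/-- The affine functions describing the sets of the volume problem. If the memory `σ` encodes the
pyramids `(x, i, s)` numbered `0, …, n`, then the rows `r < 2 * d` of the group `g ≤ n` are the
functions `s * (y i - x i) ∓ (y j - x j)` for `j < d`, and the rows of the group `n + 1` are
the functions `y j` and `1 - y j`. A point lies in the pyramid `g`, or in the unit cube
respectively, if and only if none of the rows of the group is negative at this point. -/
noncomputable def groupRow (d n : ℕ) (σ : State) (g r l : ℕ) : ℝ :=
  if g < n + 1 then
    (if l = 0 then 1 else 0) * ((1 - 2 * ((if r < d then 0 else 1 : ℕ) : ℝ)) *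
        σ.real 0 (g * d + if r < d then r else r - d) -
      (2 * (σ.nat 2 g : ℝ) - 1) * σ.real 0 (g * d + σ.nat 1 g)) +
    (2 * (σ.nat 2 g : ℝ) - 1) * (if l = σ.nat 1 g + 1 then 1 else 0) -
    (1 - 2 * ((if r < d then 0 else 1 : ℕ) : ℝ)) *
      (if l = (if r < d then r else r - d) + 1 then 1 else 0)
  else
    (if l = 0 then 1 else 0) * ((if r < d then 0 else 1 : ℕ) : ℝ) +
    (1 - 2 * ((if r < d then 0 else 1 : ℕ) : ℝ)) *
      (if l = (if r < d then r else r - d) + 1 then 1 else 0)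

/-- The matrix of all groups of rows, followed by the row of the generic linear form. -/
noncomputable def initRows (d n : ℕ) (σ : State) (i l : ℕ) : ℝ :=
  if i < (n + 2) * (d + d) then groupRow d n σ (i / (d + d)) (i % (d + d)) l else 2 ^ l

/-- One of the rows of the group `g` belongs to the set `T` of the negative rows. -/
def GroupViolated (d : ℕ) (T : Finset ℕ) (g : ℕ) : Prop := ∃ r < d + d, g * (d + d) + r ∈ T

open Classical in
/-- The indicator function of the set `X ∩ P` of the volume problem in terms of the set `T` of the
negative rows. -/
noncomputable def spaceIndicator (d n : ℕ) (T : Finset ℕ) : ℝ :=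
  ∏ g ∈ Finset.range (n + 2), if g < n then (if GroupViolated d T g then 1 else 0)
    else 1 - (if GroupViolated d T g then 1 else 0)

theorem Pyramid.mem_toSet {d : ℕ} (P : Pyramid d) (y : Fin d → ℝ) :
    y ∈ P.toSet ↔ ∀ j, |y j - P.apex j| ≤ P.sign * (y P.dir - P.apex P.dir) := by
  have hs : P.sign * (y P.dir - P.apex P.dir) ≤ ‖y - P.apex‖ := by
    refine le_trans ?_ (norm_le_pi_norm (y - P.apex) P.dir)
    rw [Real.norm_eq_abs, Pi.sub_apply]
    unfold Pyramid.sign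
    split_ifs
    · rw [one_mul]; exact le_abs_self _
    · rw [neg_one_mul]; exact neg_le_abs _
  constructor
  · intro h j
    have h' : P.sign * (y P.dir - P.apex P.dir) = ‖y - P.apex‖ := h
    rw [h']
    exact norm_le_pi_norm (y - P.apex) j
  · intro h
    refine le_antisymm hs ?_
    refine (pi_norm_le_iff_of_nonneg ((abs_nonneg _).trans (h P.dir))).2 h

theorem Pyramid.isClosed_toSet {d : ℕ} (P : Pyramid d) : IsClosed P.toSet := by
  exact isClosed_eq (by fun_prop) (by fun_prop)

theorem group_index_lt {G b g r : ℕ} (hg : g < G) (hr : r < b) : g * b + r < G * b := by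
  calc g * b + r < g * b + b := by omega
    _ = (g + 1) * b := by ring
    _ ≤ G * b := Nat.mul_le_mul_right _ hg

theorem initRows_group {d n : ℕ} (σ : State) {g r : ℕ} (hg : g < n + 2) (hr : r < d + d) :
    initRows d n σ (g * (d + d) + r) = groupRow d n σ g r := by
  have h1 : (g * (d + d) + r) / (d + d) = g := by
    rw [mul_comm, Nat.mul_add_div (by omega), Nat.div_eq_of_lt hr, add_zero]
  have h2 : (g * (d + d) + r) % (d + d) = r := by
    rw [mul_comm, Nat.mul_add_mod, Nat.mod_eq_of_lt hr]
  ext l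
  rw [initRows, if_pos (group_index_lt hg hr), h1, h2]

theorem initRows_objective (d n : ℕ) (σ : State) (l : ℕ) :
    initRows d n σ ((n + 2) * (d + d)) l = 2 ^ l := by
  simp [initRows]

section encode

variable {d m : ℕ} (n : ℕ) (S : Fin m → Pyramid d)

theorem encode_dir (g : Fin m) : (encode n S).nat 1 g = (S g).dir := by
  simp [encode]

theorem encode_sign (g : Fin m) : 2 * ((encode n S).nat 2 g : ℝ) - 1 = (S g).sign := by
  simp only [encode, Pyramid.sign]
  by_cases h : (S g).pos <;> simp [h]; norm_num

theorem encode_apex (g : Fin m) (j : Fin d) : (encode n S).real 0 (g * d + j) = (S g).apex j := by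
  have hlt := group_index_lt g.2 j.2
  have h1 : Fin.divNat (⟨g * d + j, hlt⟩ : Fin (m * d)) = g := by
    ext
    simp only [Fin.coe_divNat]
    rw [mul_comm, Nat.mul_add_div (by have := j.2; omega), Nat.div_eq_of_lt j.2, add_zero]
  have h2 : Fin.modNat (⟨g * d + j, hlt⟩ : Fin (m * d)) = j := by
    ext
    simp only [Fin.coe_modNat]
    rw [mul_comm, Nat.mul_add_mod, Nat.mod_eq_of_lt j.2]
  simp only [encode, if_true, dif_pos hlt, h1, h2]

end encode

/-- For `r = e * d + j`, the row `r` of the group `g` is the function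
`s * (y i - x i) - (1 - 2 * e) * (y j - x j)` for the pyramid `(x, i, s)` with number `g`. -/
theorem affEval_groupRow {d n : ℕ} (S : Fin (n + 1) → Pyramid d) (g : Fin (n + 1)) (e : ℕ)
    (he : e < 2) (j : Fin d) (y : Fin d → ℝ) :
    affEval d (groupRow d n (encode n S) g (e * d + j)) y =
      (S g).sign * (y (S g).dir - (S g).apex (S g).dir) -
        (1 - 2 * (e : ℝ)) * (y j - (S g).apex j) := by
  have h1 : (if e * d + j < d then 0 else 1 : ℕ) = e := by
    have := j.2
    interval_cases e <;> simp
  have h2 : (if e * d + j < d then e * d + (j : ℕ) else e * d + j - d) = j := by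
    have := j.2
    interval_cases e <;> simp
  have hg : (g : ℕ) < n + 1 := g.2
  unfold affEval
  simp only [groupRow, if_pos hg, h1, h2, encode_dir, encode_sign, encode_apex]
  simp [Finset.sum_sub_distrib, sub_mul, Fin.val_inj]
  ring

theorem affEval_groupRow_cube {d n : ℕ} (σ : State) (e : ℕ)
    (he : e < 2) (j : Fin d) (y : Fin d → ℝ) :
    affEval d (groupRow d n σ (n + 1) (e * d + j)) y = e + (1 - 2 * (e : ℝ)) * y j := by
  have h1 : (if e * d + j < d then 0 else 1 : ℕ) = e := by
    have := j.2
    interval_cases e <;> simp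
  have h2 : (if e * d + j < d then e * d + (j : ℕ) else e * d + j - d) = j := by
    have := j.2
    interval_cases e <;> simp
  unfold affEval
  simp only [groupRow, lt_irrefl, if_false, h1, h2]
  simp [Fin.val_inj]

theorem exists_group_iff {d : ℕ} (p : ℕ → Prop) :
    (∃ r < d + d, p r) ↔ ∃ j : Fin d, p (0 * d + j) ∨ p (1 * d + j) := by
  constructor
  · rintro ⟨r, hr, h⟩
    by_cases hd : r < d
    · exact ⟨⟨r, hd⟩, Or.inl (by simpa using h)⟩
    · exact ⟨⟨r - d, by omega⟩, Or.inr (by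
        rwa [show 1 * d + (⟨r - d, by omega⟩ : Fin d).1 = r by simp; omega])⟩
  · rintro ⟨j, h | h⟩
    · exact ⟨_, by have := j.2; omega, h⟩
    · exact ⟨_, by have := j.2; omega, h⟩

theorem mem_negSet_group {d n : ℕ} (σ : State) {g r : ℕ} (hg : g < n + 2) (hr : r < d + d)
    (y : Fin d → ℝ) :
    g * (d + d) + r ∈ negSet ((n + 2) * (d + d)) d (initRows d n σ) y ↔
      affEval d (groupRow d n σ g r) y < 0 := by
  simp [negSet, group_index_lt hg hr, initRows_group σ hg hr]

theorem exists_mem_negSet_group {d n : ℕ} (S : Fin (n + 1) → Pyramid d) (g : Fin (n + 1))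
    (y : Fin d → ℝ) :
    GroupViolated d (negSet ((n + 2) * (d + d)) d (initRows d n (encode n S)) y) g ↔
      y ∉ (S g).toSet := by
  have hg : (g : ℕ) < n + 2 := by omega
  have : GroupViolated d (negSet ((n + 2) * (d + d)) d (initRows d n (encode n S)) y) g ↔
      ∃ r < d + d, affEval d (groupRow d n (encode n S) g r) y < 0 :=
    exists_congr fun r => and_congr_right fun hr => mem_negSet_group _ hg hr y
  rw [this, exists_group_iff, Pyramid.mem_toSet, not_forall]
  refine exists_congr fun j => ?_
  rw [affEval_groupRow S g 0 (by norm_num), affEval_groupRow S g 1 (by norm_num), not_le, lt_abs]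
  refine or_congr ?_ ?_ <;> constructor <;> intro h <;> push_cast at * <;> linarith

theorem exists_mem_negSet_cube {d n : ℕ} (σ : State) (y : Fin d → ℝ) :
    GroupViolated d (negSet ((n + 2) * (d + d)) d (initRows d n σ) y) (n + 1) ↔
      y ∉ Set.Icc (0 : Fin d → ℝ) 1 := by
  have : GroupViolated d (negSet ((n + 2) * (d + d)) d (initRows d n σ) y) (n + 1) ↔
      ∃ r < d + d, affEval d (groupRow d n σ (n + 1) r) y < 0 :=
    exists_congr fun r => and_congr_right fun hr => mem_negSet_group _ (by omega) hr y
  rw [this, exists_group_iff, ← Set.pi_univ_Icc]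
  simp only [Set.mem_pi, Set.mem_univ, true_implies, not_forall, Set.mem_Icc, not_and_or, not_le]
  refine exists_congr fun j => ?_
  rw [affEval_groupRow_cube σ 0 (by norm_num), affEval_groupRow_cube σ 1 (by norm_num)]
  refine or_congr ?_ ?_ <;> constructor <;> intro h <;> push_cast at * <;>
    simp only [Pi.zero_apply, Pi.one_apply] at * <;> linarith

open Classical in
theorem spaceIndicator_negSet {d n : ℕ} (Q : Fin n → Pyramid d) (P : Pyramid d) (y : Fin d → ℝ) :
    spaceIndicator d n (negSet ((n + 2) * (d + d)) d (initRows d n (volumeInput Q P)) y) =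
      (searchSpace Q ∩ P.toSet).indicator 1 y := by
  set T := negSet ((n + 2) * (d + d)) d (initRows d n (volumeInput Q P)) y with hT
  have hQ : ∀ g : Fin n, GroupViolated d T g ↔ y ∉ (Q g).toSet := by
    intro g
    have := exists_mem_negSet_group (Fin.snoc (α := fun _ => Pyramid d) Q P) g.castSucc y
    rw [hT, volumeInput]
    simpa using this
  have hP : GroupViolated d T n ↔ y ∉ P.toSet := by
    have := exists_mem_negSet_group (Fin.snoc (α := fun _ => Pyramid d) Q P) (Fin.last n) y
    rw [hT, volumeInput]
    simpa using this
  have hC : GroupViolated d T (n + 1) ↔ y ∉ Set.Icc (0 : Fin d → ℝ) 1 :=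
    exists_mem_negSet_cube _ y
  rw [spaceIndicator, Finset.prod_range_succ, Finset.prod_range_succ,
    if_neg (lt_irrefl n), if_neg (show ¬ n + 1 < n by omega)]
  simp only [hP, hC]
  have hprod : (∏ g ∈ Finset.range n, if g < n then (if GroupViolated d T g then (1 : ℝ) else 0)
      else 1 - (if GroupViolated d T g then 1 else 0)) =
      if y ∈ ⋃ k, (Q k).toSet then 0 else 1 := by
    rw [Finset.prod_range fun g => if g < n then (if GroupViolated d T g then (1 : ℝ) else 0)
      else 1 - (if GroupViolated d T g then 1 else 0)]
    simp only [Fin.is_lt, if_true, hQ]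
    split_ifs with h
    · obtain ⟨g, hg⟩ := Set.mem_iUnion.1 h
      exact Finset.prod_eq_zero (Finset.mem_univ g) (if_neg (not_not.2 hg))
    · exact Finset.prod_eq_one fun g _ => if_pos fun hg => h (Set.mem_iUnion.2 ⟨g, hg⟩)
  rw [hprod, Set.indicator_apply]
  simp only [searchSpace, Set.mem_inter_iff, Set.mem_sdiff]
  by_cases h1 : y ∈ ⋃ k, (Q k).toSet <;> by_cases h2 : y ∈ P.toSet <;>
    by_cases h3 : y ∈ Set.Icc (0 : Fin d → ℝ) 1 <;> simp [h1, h2, h3]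

theorem admissible_initRows {d n : ℕ} (Q : Fin n → Pyramid d) (P : Pyramid d) :
    Admissible ((n + 2) * (d + d)) d (spaceIndicator d n) (initRows d n (volumeInput Q P)) := by
  have hsg : ∀ g < n + 1, 2 * ((volumeInput Q P).nat 2 g : ℝ) - 1 = 1 ∨
      2 * ((volumeInput Q P).nat 2 g : ℝ) - 1 = -1 := by
    intro g hg
    rw [volumeInput, encode_sign n _ ⟨g, hg⟩, Pyramid.sign]
    split_ifs <;> simp
  have hvanish : ∀ r < d + d, ∀ T, (n + 1) * (d + d) + r ∈ T → spaceIndicator d n T = 0 := by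
    intro r hr T hT
    refine Finset.prod_eq_zero (i := n + 1) (by simp) ?_
    rw [if_neg (by omega), if_pos ⟨r, hr, hT⟩, sub_self]
  have htail : ∀ i < (n + 2) * (d + d), ∃ (s t : ℝ) (a b : ℕ), (s = 0 ∨ s = 1 ∨ s = -1) ∧
      (t = 1 ∨ t = -1) ∧ ∀ l, initRows d n (volumeInput Q P) i (l + 1) =
        s * (if l = a then 1 else 0) + t * (if l = b then 1 else 0) := by
    intro i hi
    set g := i / (d + d)
    set r := i % (d + d)
    have ht : (1 - 2 * ((if r < d then 0 else 1 : ℕ) : ℝ)) = 1 ∨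
        (1 - 2 * ((if r < d then 0 else 1 : ℕ) : ℝ)) = -1 := by
      split_ifs <;> norm_num
    by_cases hg : g < n + 1
    · refine ⟨_, -(1 - 2 * ((if r < d then 0 else 1 : ℕ) : ℝ)), (volumeInput Q P).nat 1 g,
        if r < d then r else r - d, Or.inr (hsg g hg), ?_,
        fun l => ?_⟩
      · rcases ht with h | h <;> rw [h]
        · exact Or.inr rfl
        · exact Or.inl (neg_neg 1)
      · rw [initRows, if_pos hi, groupRow, if_pos hg]
        simp only [Nat.succ_ne_zero, if_false, zero_mul, zero_add, Nat.add_right_cancel_iff,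
          neg_mul, sub_eq_add_neg]
        rfl
    · refine ⟨0, (1 - 2 * ((if r < d then 0 else 1 : ℕ) : ℝ)), 0,
        if r < d then r else r - d, Or.inl rfl, ht, fun l => ?_⟩
      rw [initRows, if_pos hi, groupRow, if_neg hg]
      simp only [Nat.succ_ne_zero, if_false, zero_mul, zero_add, Nat.add_right_cancel_iff]
      rfl
  refine ⟨?_, ?_, ?_, ?_, ?_⟩
  · intro i hi l₁ l₂ l₃ h₁ h₂ h₃
    obtain ⟨s, t, a, b, -, -, h⟩ := htail i hi
    simp only [h]
    have : (l₁ ≠ a ∧ l₁ ≠ b) ∨ (l₂ ≠ a ∧ l₂ ≠ b) ∨ (l₃ ≠ a ∧ l₃ ≠ b) := by omega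
    rcases this with h | h | h
    · left; simp [h]
    · right; left; simp [h]
    · right; right; simp [h]
  · intro i hi l₁ l₂ h₁ h₂
    obtain ⟨s, t, a, b, hs, ht, h⟩ := htail i hi
    simp only [h]
    rcases hs with rfl | rfl | rfl <;> rcases ht with rfl | rfl <;> split_ifs <;>
      (first | omega | norm_num)
  · intro l hl
    exact ⟨0, by rw [initRows_objective]; simp⟩
  · intro l hl
    refine ⟨(n + 1) * (d + d) + l, group_index_lt (by omega) (by omega),
      hvanish l (by omega), ?_⟩
    rw [initRows_group _ (by omega) (by omega)]
    ext m
    simp [groupRow, hl]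
  · intro l hl
    refine ⟨(n + 1) * (d + d) + (d + l), group_index_lt (by omega) (by omega),
      hvanish (d + l) (by omega), ?_⟩
    rw [initRows_group _ (by omega) (by omega)]
    ext m
    have : ¬ d + l < d := by omega
    rcases m with _ | m
    · simp [groupRow]
    · simp only [groupRow, this, lt_irrefl, if_false]
      by_cases h : m = l <;> simp [h]; norm_num

/-- The volume of `X ∩ P` is a sum of `(2 * N) ^ d` explicitly computable terms, for
`N = (n + 2) * 2 * d` hyperplanes. -/
theorem volume_eq_sum_flagTerm {d n : ℕ} (Q : Fin n → Pyramid d) (P : Pyramid d) :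
    (volume (searchSpace Q ∩ P.toSet)).toReal =
      ∑ x ∈ Finset.range (((n + 2) * (d + d) + (n + 2) * (d + d)) ^ d),
        flagTerm ((n + 2) * (d + d)) (spaceIndicator d n)
          (fun l => x / ((n + 2) * (d + d) + (n + 2) * (d + d)) ^ l %
            ((n + 2) * (d + d) + (n + 2) * (d + d))) d 0 (initRows d n (volumeInput Q P)) := by
  rw [← (admissible_initRows Q P).integral_eq_sum 0]
  have hm : MeasurableSet (searchSpace Q ∩ P.toSet) :=
    (measurableSet_Icc.diff (MeasurableSet.iUnion fun k =>
      (Q k).isClosed_toSet.measurableSet)).inter P.isClosed_toSet.measurableSet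
  simp only [pow_zero, Nat.factorial_zero, Nat.cast_one, div_one, mul_one, spaceIndicator_negSet]
  rw [integral_indicator_one hm, Measure.real]

/-! ### A program logic with time bounds -/

namespace RealRAM

/-- The natural arrays that occur on the left of an assignment. -/
def Prog.natWrites : Prog → List ℕ
  | .skip => []
  | .setNat a _ _ => [a]
  | .setReal _ _ _ => []
  | .seq p q => p.natWrites ++ q.natWrites
  | .ite _ p q => p.natWrites ++ q.natWrites
  | .loop _ p => p.natWrites

/-- The real arrays that occur on the left of an assignment. -/
def Prog.realWrites : Prog → List ℕ
  | .skip => []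
  | .setNat _ _ _ => []
  | .setReal a _ _ => [a]
  | .seq p q => p.realWrites ++ q.realWrites
  | .ite _ p q => p.realWrites ++ q.realWrites
  | .loop _ p => p.realWrites

/-- A bound on the running time of a program each of whose loops performs at most `L` rounds
whenever it is entered. -/
def Prog.budget (L : ℕ) : Prog → ℕ
  | .skip => 1
  | .setNat _ i e => i.cost + e.cost + 1
  | .setReal _ i e => i.cost + e.cost + 1
  | .seq p q => p.budget L + q.budget L
  | .ite b p q => b.cost + (p.budget L + q.budget L) + 1
  | .loop b p => L * (b.cost + p.budget L + 1) + (b.cost + 1)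

/-- The maximal nesting of loops. -/
def Prog.depth : Prog → ℕ
  | .skip => 0
  | .setNat _ _ _ => 0
  | .setReal _ _ _ => 0
  | .seq p q => max p.depth q.depth
  | .ite _ p q => max p.depth q.depth
  | .loop _ p => p.depth + 1

/-- The budget is a polynomial in `L` with natural coefficients, of degree at most the depth. -/
theorem Prog.budget_le (p : Prog) {L : ℕ} (hL : 1 ≤ L) :
    p.budget L ≤ p.budget 1 * L ^ p.depth := by
  have key : ∀ (q : Prog) (e : ℕ), q.depth ≤ e → q.budget L ≤ q.budget 1 * L ^ q.depth →
      q.budget L ≤ q.budget 1 * L ^ e := fun q e he h =>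
    h.trans (Nat.mul_le_mul_left _ (Nat.pow_le_pow_right hL he))
  have one : ∀ (c e : ℕ), c ≤ c * L ^ e := fun c e => Nat.le_mul_of_pos_right _ (by positivity)
  induction p with
  | skip => simp [budget, depth]
  | setNat a i e => simp [budget, depth]
  | setReal a i e => simp [budget, depth]
  | seq p q hp hq =>
    have h1 := key p _ (le_max_left p.depth q.depth) hp
    have h2 := key q _ (le_max_right p.depth q.depth) hq
    simp only [budget, depth, add_mul]
    omega
  | ite b p q hp hq =>
    have h1 := key p _ (le_max_left p.depth q.depth) hp
    have h2 := key q _ (le_max_right p.depth q.depth) hq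
    have h3 := one (b.cost + 1) (max p.depth q.depth)
    simp only [budget, depth, add_mul] at *
    omega
  | loop b p hp =>
    have h3 := one (b.cost + 1) (p.depth + 1)
    have h4 : L * (b.cost + p.budget L + 1) ≤
        (1 * (b.cost + p.budget 1 + 1)) * L ^ (p.depth + 1) := by
      have h5 := one (b.cost + 1) p.depth
      calc L * (b.cost + p.budget L + 1)
          ≤ L * ((b.cost + p.budget 1 + 1) * L ^ p.depth) := by
            refine Nat.mul_le_mul_left _ ?_
            simp only [add_mul] at *
            omega
        _ = _ := by ring
    simp only [budget, depth]
    rw [add_mul]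
    exact Nat.add_le_add h4 h3

/-- The memories `σ` and `τ` agree on all arrays to which `p` does not write. -/
def Frame (p : Prog) (σ τ : State) : Prop :=
  (∀ a, a ∉ p.natWrites → τ.nat a = σ.nat a) ∧ (∀ a, a ∉ p.realWrites → τ.real a = σ.real a)

section State

variable (σ : State) (a b k j v : ℕ) (x : ℝ)

@[simp] theorem State.setNat_nat_self :
    (σ.setNat a k v).nat a j = if j = k then v else σ.nat a j := by
  simp [State.setNat]

theorem State.setNat_nat_of_ne {a b : ℕ} (h : b ≠ a) : (σ.setNat a k v).nat b = σ.nat b := by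
  ext j; simp [State.setNat, h]

@[simp] theorem State.setNat_real : (σ.setNat a k v).real = σ.real := rfl

@[simp] theorem State.setReal_real_self :
    (σ.setReal a k x).real a j = if j = k then x else σ.real a j := by
  simp [State.setReal]

theorem State.setReal_real_of_ne {a b : ℕ} (h : b ≠ a) : (σ.setReal a k x).real b = σ.real b := by
  ext j; simp [State.setReal, h]

@[simp] theorem State.setReal_nat : (σ.setReal a k x).nat = σ.nat := rfl

end State

theorem Runs.frame {p : Prog} {σ τ : State} {t : ℕ} (h : Runs p σ t τ) : Frame p σ τ := by
  induction h with
  | skip σ => exact ⟨fun _ _ => rfl, fun _ _ => rfl⟩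
  | setNat σ a i e =>
    exact ⟨fun b hb => σ.setNat_nat_of_ne _ _ (by simpa [Prog.natWrites] using hb), fun _ _ => rfl⟩
  | setReal σ a i e =>
    exact ⟨fun _ _ => rfl,
      fun b hb => σ.setReal_real_of_ne _ _ (by simpa [Prog.realWrites] using hb)⟩
  | seq _ _ h₁ h₂ =>
    constructor <;> intro a ha <;>
      simp only [Prog.natWrites, Prog.realWrites, List.mem_append, not_or] at ha
    · rw [h₂.1 a ha.2, h₁.1 a ha.1]
    · rw [h₂.2 a ha.2, h₁.2 a ha.1]
  | ite_true _ _ h =>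
    constructor <;> intro a ha <;>
      simp only [Prog.natWrites, Prog.realWrites, List.mem_append, not_or] at ha
    · exact h.1 a ha.1
    · exact h.2 a ha.1
  | ite_false _ _ h =>
    constructor <;> intro a ha <;>
      simp only [Prog.natWrites, Prog.realWrites, List.mem_append, not_or] at ha
    · exact h.1 a ha.2
    · exact h.2 a ha.2
  | loop_stop _ => exact ⟨fun _ _ => rfl, fun _ _ => rfl⟩
  | loop_step _ _ _ h₁ h₂ =>
    exact ⟨fun a ha => (h₂.1 a ha).trans (h₁.1 a ha), fun a ha => (h₂.2 a ha).trans (h₁.2 a ha)⟩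

/-- Started in `σ`, the program `p` halts within its time budget, in a state with property `Q`. -/
def Halts (L : ℕ) (p : Prog) (σ : State) (Q : State → Prop) : Prop :=
  ∃ t τ, Runs p σ t τ ∧ t ≤ p.budget L ∧ Q τ

namespace Halts

variable {L : ℕ} {p q : Prog} {σ : State} {Q Q' : State → Prop}

/-- The postcondition may be weakened, using that `p` respects its frame. -/
theorem imp (h : Halts L p σ Q) (hQ : ∀ τ, Frame p σ τ → Q τ → Q' τ) : Halts L p σ Q' := by
  obtain ⟨t, τ, hr, ht, hq⟩ := h
  exact ⟨t, τ, hr, ht, hQ τ hr.frame hq⟩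

theorem skip (h : Q σ) : Halts L .skip σ Q := ⟨1, σ, .skip σ, le_rfl, h⟩

theorem setNat {a : ℕ} {i e : NExpr} (h : Q (σ.setNat a (i.eval σ) (e.eval σ))) :
    Halts L (.setNat a i e) σ Q := ⟨_, _, .setNat σ a i e, le_rfl, h⟩

theorem setReal {a : ℕ} {i : NExpr} {e : RExpr} (h : Q (σ.setReal a (i.eval σ) (e.eval σ))) :
    Halts L (.setReal a i e) σ Q := ⟨_, _, .setReal σ a i e, le_rfl, h⟩

theorem seq (h : Halts L p σ fun τ => Halts L q τ Q) : Halts L (.seq p q) σ Q := by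
  obtain ⟨t, τ, hr, ht, t', τ', hr', ht', hq⟩ := h
  exact ⟨_, _, .seq hr hr', Nat.add_le_add ht ht', hq⟩

theorem ite {b : BExpr} (hp : b.Holds σ → Halts L p σ Q) (hq : ¬ b.Holds σ → Halts L q σ Q) :
    Halts L (.ite b p q) σ Q := by
  by_cases hb : b.Holds σ
  · obtain ⟨t, τ, hr, ht, h⟩ := hp hb
    exact ⟨_, _, .ite_true hb hr, by simp only [Prog.budget]; omega, h⟩
  · obtain ⟨t, τ, hr, ht, h⟩ := hq hb
    exact ⟨_, _, .ite_false hb hr, by simp only [Prog.budget]; omega, h⟩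

end Halts

/-- The content of cell `0` of the natural array `a`, which serves as a variable. -/
def NExpr.var (a : ℕ) : NExpr := .get a (.const 0)

/-- The content of cell `0` of the real array `a`, which serves as a variable. -/
def RExpr.var (a : ℕ) : RExpr := .get a (.const 0)

@[simp] theorem NExpr.eval_var (σ : State) (a : ℕ) : (NExpr.var a).eval σ = σ.nat a 0 := rfl

@[simp] theorem RExpr.eval_var (σ : State) (a : ℕ) : (RExpr.var a).eval σ = σ.real a 0 := rfl

/-- The loop that performs `body` with the variable `v` running through the numbers below the
content of cell `c` of the natural array `b`. -/
def Prog.forLoop (v b c : ℕ) (body : Prog) : Prog :=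
  .seq (.setNat v (.const 0) (.const 0))
    (.loop (.natLt (.var v) (.get b (.const c)))
      (.seq body (.setNat v (.const 0) (.add (.var v) (.const 1)))))

/-- The rule for counting loops with the invariant `I`, which refers to the state at the beginning
of round `i`. The body must not write to the counter nor to the array that holds the bound. -/
theorem Halts.forLoop {L v b c m : ℕ} {body : Prog} {σ : State} {Q : State → Prop}
    (I : ℕ → State → Prop) (hm : σ.nat b c = m) (hmL : m ≤ L) (hbv : b ≠ v)
    (hv : v ∉ body.natWrites) (hb : b ∉ body.natWrites) (h0 : I 0 (σ.setNat v 0 0))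
    (hstep : ∀ i < m, ∀ τ, Frame (.forLoop v b c body) σ τ → τ.nat v 0 = i → I i τ →
      Halts L body τ fun τ' => I (i + 1) (τ'.setNat v 0 (i + 1)))
    (hQ : ∀ τ, Frame (.forLoop v b c body) σ τ → I m τ → Q τ) :
    Halts L (.forLoop v b c body) σ Q := by
  set guard : BExpr := .natLt (.var v) (.get b (.const c)) with hguard
  set round : Prog := .seq body (.setNat v (.const 0) (.add (.var v) (.const 1))) with hround
  have hFN : (Prog.forLoop v b c body).natWrites = v :: (body.natWrites ++ [v]) := rfl
  have hFR : (Prog.forLoop v b c body).realWrites = body.realWrites ++ [] := rfl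
  have holds : ∀ τ : State, guard.Holds τ ↔ τ.nat v 0 < τ.nat b c := fun τ => Iff.rfl
  -- `r` is the number of remaining rounds.
  have main : ∀ r i τ, i + r = m → Frame (.forLoop v b c body) σ τ → τ.nat v 0 = i →
      τ.nat b c = m → I i τ → ∃ t τ', Runs (.loop guard round) τ t τ' ∧
        t ≤ r * (guard.cost + round.budget L + 1) + (guard.cost + 1) ∧
        Frame (.forLoop v b c body) σ τ' ∧ I m τ' := by
    intro r
    induction r with
    | zero =>
      intro i τ hi hF hvi hbm hI
      refine ⟨_, τ, Runs.loop_stop ?_, by simp, hF, by rwa [← hi]⟩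
      rw [holds]; omega
    | succ r ih =>
      intro i τ hi hF hvi hbm hI
      obtain ⟨t, τ₁, hr, ht, hI₁⟩ := hstep i (by omega) τ hF hvi hI
      have hfr := hr.frame
      have hr₁ : Runs round τ (t + _) _ := .seq hr (.setNat τ₁ v (.const 0) _)
      have hval : NExpr.eval τ₁ (.add (.var v) (.const 1)) = i + 1 := by
        simp only [NExpr.eval, NExpr.eval_var, hfr.1 v hv, hvi]
      rw [hval] at hr₁
      have hF₁ : Frame (.forLoop v b c body) σ (τ₁.setNat v 0 (i + 1)) := by
        constructor
        · intro a ha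
          rw [hFN] at ha
          simp only [List.mem_cons, List.mem_append, not_or] at ha
          rw [State.setNat_nat_of_ne _ _ _ ha.1, hfr.1 a ha.2.1, hF.1 a (by simp [hFN, ha])]
        · intro a ha
          have ha' : a ∉ body.realWrites := by simpa [hFR] using ha
          rw [State.setNat_real, hfr.2 a ha', hF.2 a ha]
      have hb₁ : (τ₁.setNat v 0 (i + 1)).nat b c = m := by
        rw [State.setNat_nat_of_ne _ _ _ hbv, hfr.1 b hb, hbm]
      obtain ⟨t', τ', hr', ht', hF', hI'⟩ := ih (i + 1) (τ₁.setNat v 0 (i + 1)) (by omega) hF₁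
        (by simp) hb₁ hI₁
      refine ⟨_, τ', .loop_step ((holds τ).2 (by omega)) hr₁ hr', ?_, hF', hI'⟩
      have : t + ((NExpr.const 0).cost + (NExpr.add (.var v) (.const 1)).cost + 1) ≤
          round.budget L := by
        simp only [hround, Prog.budget]; omega
      rw [Nat.succ_mul]
      omega
  obtain ⟨t, τ', hr, ht, hF, hI⟩ := main m 0 (σ.setNat v 0 0) (by omega)
    ⟨fun a ha => σ.setNat_nat_of_ne _ _ (by rw [hFN] at ha; simp at ha; tauto), fun _ _ => rfl⟩
    (by simp) (by rw [State.setNat_nat_of_ne _ _ _ hbv, hm]) h0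
  refine ⟨_, τ', .seq (.setNat σ v (.const 0) (.const 0)) hr, ?_, hQ τ' hF hI⟩
  have : m * (guard.cost + round.budget L + 1) ≤ L * (guard.cost + round.budget L + 1) :=
    Nat.mul_le_mul_right _ hmL
  simp only [Prog.forLoop, Prog.budget, ← hguard, ← hround] at *
  omega

end RealRAM

/-! ### The program

The arrays that are used as variables or tables are the following.

* Natural arrays: `3` the number `2 * d` of rows in a group, `4` the width `d + 1` of a row, `5` the
  number `N` of rows, `6` the base `2 * N` of the digits, `7` the table of the addresses
  `i * (d + 1)` at which the rows start, `8` the number `n + 2` of groups, `9` the number `N + 1`,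
  `10` the carry, `11` the digits, `12` the current group, `13` the current row in its group, `14`
  the current column, `15` the current row, `16` the address of the current apex, `17` the column
  index `j` or the pivot row, `18` the choice of the sign of `y j - x j`, `19` the number of
  eliminated coordinates, `20` the column to be eliminated, `21` the side of the pivot hyperplane,
  `22` whether the current group is violated.
* Real arrays: `1` the output, `2` the matrix, `3` a copy of the pivot row, `4` the coefficient to
  be eliminated, `5` its quotient by the pivot, `6` a sum of squares, `7` the product of the factors
  of the current term, `8` the table of the powers of `2`. -/

namespace RealRAM

/-- `1` if the values of `e` and `f` agree, and `0` otherwise. -/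
def NExpr.delta (e f : NExpr) : NExpr := .sub (.const 1) (.add (.sub e f) (.sub f e))

theorem NExpr.eval_delta (σ : State) (e f : NExpr) :
    (NExpr.delta e f).eval σ = if e.eval σ = f.eval σ then 1 else 0 := by
  simp only [delta, eval]
  split_ifs <;> omega

theorem NExpr.cast_eval_delta (σ : State) (e f : NExpr) :
    (((NExpr.delta e f).eval σ : ℕ) : ℝ) = if e.eval σ = f.eval σ then 1 else 0 := by
  rw [eval_delta]; split_ifs <;> simp

/-- Fills row number `var 15` of the matrix with the values of `e` for `var 14 = 0, …, d`. -/
def fillRow (e : RExpr) : Prog :=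
  .forLoop 14 4 0 (.setReal 2 (.add (.get 7 (.var 15)) (.var 14)) e)

/-- Writes the matrix `initRows` into memory. -/
def buildMatrix : Prog :=
  .seq (.setNat 15 (.const 0) (.const 0)) <|
  .seq (.setNat 16 (.const 0) (.const 0)) <|
  .seq (.forLoop 12 8 0 <|
    .seq (.forLoop 13 3 0 <|
      .seq (.ite (.natLt (.var 13) (.var 0))
        (.seq (.setNat 17 (.const 0) (.var 13)) (.setNat 18 (.const 0) (.const 0)))
        (.seq (.setNat 17 (.const 0) (.sub (.var 13) (.var 0)))
          (.setNat 18 (.const 0) (.const 1)))) <|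
      .seq (.ite (.natLt (.var 12) (.add (.get 0 (.const 1)) (.const 1)))
        (fillRow <|
          .sub (.add (.mul (.ofNat (.delta (.var 14) (.const 0)))
            (.sub (.mul (.sub (.const 1) (.mul (.const 2) (.ofNat (.var 18))))
              (.get 0 (.add (.var 16) (.var 17))))
              (.mul (.sub (.mul (.const 2) (.ofNat (.get 2 (.var 12)))) (.const 1))
                (.get 0 (.add (.var 16) (.get 1 (.var 12)))))))
            (.mul (.sub (.mul (.const 2) (.ofNat (.get 2 (.var 12)))) (.const 1))
              (.ofNat (.delta (.var 14) (.add (.get 1 (.var 12)) (.const 1))))))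
            (.mul (.sub (.const 1) (.mul (.const 2) (.ofNat (.var 18))))
              (.ofNat (.delta (.var 14) (.add (.var 17) (.const 1))))))
        (fillRow <|
          .add (.mul (.ofNat (.delta (.var 14) (.const 0))) (.ofNat (.var 18)))
            (.mul (.sub (.const 1) (.mul (.const 2) (.ofNat (.var 18))))
              (.ofNat (.delta (.var 14) (.add (.var 17) (.const 1))))))) <|
      .setNat 15 (.const 0) (.add (.var 15) (.const 1))) <|
    .setNat 16 (.const 0) (.add (.var 16) (.var 0))) <|
  fillRow (.get 8 (.var 14))

/-- Applies the elimination step `reduceRows` to the row number `var 15`. Whether the new row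
vanishes is tested by means of the sum of the squares of its entries. -/
def elimRow : Prog :=
  .seq (.setReal 4 (.const 0) (.get 2 (.add (.get 7 (.var 15)) (.var 20)))) <|
  .seq (.setReal 5 (.const 0) (.div (.var 4) (.get 3 (.var 20)))) <|
  .seq (fillRow (.sub (.get 2 (.add (.get 7 (.var 15)) (.var 14)))
    (.mul (.var 5) (.get 3 (.var 14))))) <|
  .seq (.setReal 6 (.const 0) (.const 0)) <|
  .seq (.forLoop 14 20 0 <|
    .setReal 6 (.const 0) (.add (.var 6) (.mul (.get 2 (.add (.get 7 (.var 15)) (.var 14)))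
      (.get 2 (.add (.get 7 (.var 15)) (.var 14)))))) <|
  .ite (.and (.natLt (.var 15) (.var 5)) (.and (.realLt (.const 0) (.mul (.var 4) (.var 4)))
      (.not (.realLt (.const 0) (.var 6)))))
    (fillRow <| .mul (.ofNat (.delta (.var 14) (.const 0))) <|
      .mul (.sub (.mul (.const 2) (.ofNat (.sub (.const 1) (.sub (.add (.var 15) (.const 1))
        (.add (.var 17) (.var 21)))))) (.const 1)) (.var 4))
    .skip

/-- Eliminates the coordinates `d - 1, …, 0` as prescribed by the digits, and multiplies the
variable `7` by the weights of the pivots. -/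
def eliminate : Prog :=
  .forLoop 19 0 0 <|
    .seq (.setNat 20 (.const 0) (.sub (.var 0) (.var 19))) <|
    .seq (.setNat 17 (.const 0) (.get 11 (.sub (.var 20) (.const 1)))) <|
    .seq (.setNat 21 (.const 0) (.const 0)) <|
    .seq (.ite (.natLt (.var 17) (.var 5)) .skip
      (.seq (.setNat 17 (.const 0) (.sub (.var 17) (.var 5)))
        (.setNat 21 (.const 0) (.const 1)))) <|
    .seq (.forLoop 14 4 0 <|
      .setReal 3 (.var 14) (.get 2 (.add (.get 7 (.var 17)) (.var 14)))) <|
    .seq (.setReal 7 (.const 0) <| .mul (.var 7) <|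
      .div (.mul (.sub (.const 1) (.mul (.const 2) (.ofNat (.var 21))))
        (.div (.get 3 (.var 20)) (.get 3 (.var 20))))
        (.get 2 (.add (.get 7 (.var 5)) (.var 20)))) <|
    .forLoop 15 9 0 elimRow

/-- Multiplies the variable `7` by the value of `spaceIndicator`. -/
def checkGroups : Prog :=
  .seq (.setNat 15 (.const 0) (.const 0)) <|
  .forLoop 12 8 0 <|
    .seq (.setNat 22 (.const 0) (.const 0)) <|
    .seq (.forLoop 13 3 0 <|
      .seq (.ite (.realLt (.get 2 (.get 7 (.var 15))) (.const 0))
        (.setNat 22 (.const 0) (.const 1)) .skip) <|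
      .setNat 15 (.const 0) (.add (.var 15) (.const 1))) <|
    .ite (.natLt (.var 12) (.get 0 (.const 1)))
      (.setReal 7 (.const 0) (.mul (.var 7) (.ofNat (.var 22))))
      (.setReal 7 (.const 0) (.mul (.var 7) (.sub (.const 1) (.ofNat (.var 22)))))

/-- Multiplies the variable `7` by `c ^ d / d!` for the constant term `c` of the last row. -/
def multiplyPower : Prog :=
  .forLoop 14 0 0 <|
    .setReal 7 (.const 0) (.mul (.var 7) (.div (.get 2 (.get 7 (.var 5)))
      (.ofNat (.add (.var 14) (.const 1)))))

/-- Adds the contribution of the flag that belongs to the current digits to the output. -/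
def addFlagTerm : Prog :=
  .seq (.setReal 7 (.const 0) (.const 1)) <|
  .seq buildMatrix <|
  .seq eliminate <|
  .seq checkGroups <|
  .seq multiplyPower <|
  .setReal 1 (.const 0) (.add (.var 1) (.var 7))

/-- Increments the number with the given digits in base `var 6`; the variable `10` is the carry. -/
def increment : Prog :=
  .seq (.setNat 10 (.const 0) (.const 1)) <|
  .forLoop 14 0 0 <|
    .ite (.natLt (.const 0) (.var 10))
      (.ite (.natLt (.add (.get 11 (.var 14)) (.const 1)) (.var 6))
        (.seq (.setNat 11 (.var 14) (.add (.get 11 (.var 14)) (.const 1)))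
          (.setNat 10 (.const 0) (.const 0)))
        (.setNat 11 (.var 14) (.const 0)))
      .skip

/-- Computes the constants and tables that the other parts of the program use. -/
def prepare : Prog :=
  .seq (.setNat 3 (.const 0) (.add (.var 0) (.var 0))) <|
  .seq (.setNat 4 (.const 0) (.add (.var 0) (.const 1))) <|
  .seq (.setNat 8 (.const 0) (.add (.get 0 (.const 1)) (.const 2))) <|
  .seq (.forLoop 12 8 0 <| .setNat 5 (.const 0) (.add (.var 5) (.var 3))) <|
  .seq (.setNat 6 (.const 0) (.add (.var 5) (.var 5))) <|
  .seq (.setNat 9 (.const 0) (.add (.var 5) (.const 1))) <|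
  .seq (.forLoop 15 5 0 <|
    .setNat 7 (.add (.var 15) (.const 1)) (.add (.get 7 (.var 15)) (.var 4))) <|
  .seq (.setReal 8 (.const 0) (.const 1)) <|
  .forLoop 14 0 0 <|
    .setReal 8 (.add (.var 14) (.const 1)) (.add (.get 8 (.var 14)) (.get 8 (.var 14)))

/-- Adds up the contributions of all flags. -/
def sumFlags : Prog := .loop (.natLt (.var 10) (.const 1)) (.seq addFlagTerm increment)

/-- The program that computes the volume. -/
def volumeProg : Prog := .seq prepare sumFlags

/-- The memory `τ` contains the constants and tables computed by `prepare` from the input `σ₀`. -/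
structure Ready (d n N : ℕ) (σ₀ τ : State) : Prop where
  dim : τ.nat 0 0 = d
  num : τ.nat 0 1 = n
  dir : τ.nat 1 = σ₀.nat 1
  sign : τ.nat 2 = σ₀.nat 2
  apex : τ.real 0 = σ₀.real 0
  groupSize : τ.nat 3 0 = d + d
  width : τ.nat 4 0 = d + 1
  rows : τ.nat 5 0 = N
  base : τ.nat 6 0 = N + N
  start : ∀ i ≤ N, τ.nat 7 i = i * (d + 1)
  groups : τ.nat 8 0 = n + 2
  rows_succ : τ.nat 9 0 = N + 1
  power : ∀ l ≤ d, τ.real 8 l = 2 ^ l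

theorem Ready.congr {d n N : ℕ} {σ₀ σ τ : State} (h : Ready d n N σ₀ σ)
    (hn : ∀ a < 10, τ.nat a = σ.nat a) (h0 : τ.real 0 = σ.real 0) (h8 : τ.real 8 = σ.real 8) :
    Ready d n N σ₀ τ := by
  obtain ⟨a1, a2, a3, a4, a5, a6, a7, a8, a9, a10, a11, a12, a13⟩ := h
  constructor <;> simp only [hn 0 (by decide), hn 1 (by decide), hn 2 (by decide),
    hn 3 (by decide), hn 4 (by decide), hn 5 (by decide), hn 6 (by decide), hn 7 (by decide),
    hn 8 (by decide), hn 9 (by decide), h0, h8] <;> assumption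

theorem Ready.frame {d n N : ℕ} {σ₀ σ τ : State} {p : Prog} (h : Ready d n N σ₀ σ)
    (hF : Frame p σ τ) (hn : ∀ a < 10, a ∉ p.natWrites)
    (hr : 0 ∉ p.realWrites ∧ 8 ∉ p.realWrites) : Ready d n N σ₀ τ :=
  h.congr (fun a ha => hF.1 a (hn a ha)) (hF.2 0 hr.1) (hF.2 8 hr.2)

/-! ### Correctness of the program -/

/-- Cells of the matrix with different indices have different addresses. -/
theorem mul_add_inj {w i i' l l' : ℕ} (hl : l < w) (hl' : l' < w) :
    i * w + l = i' * w + l' ↔ i = i' ∧ l = l' := by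
  constructor
  · intro h
    have h1 : (i * w + l) / w = i := by
      rw [mul_comm, Nat.mul_add_div (by omega), Nat.div_eq_of_lt hl, add_zero]
    have h2 : (i' * w + l') / w = i' := by
      rw [mul_comm, Nat.mul_add_div (by omega), Nat.div_eq_of_lt hl', add_zero]
    have : i = i' := by rw [← h1, h, h2]
    subst this
    exact ⟨rfl, by omega⟩
  · rintro ⟨rfl, rfl⟩; rfl

/-- `fillRow e` changes row `i₀` only, provided that the value of `e` at column `l` depends on
nothing that the previous rounds have overwritten. -/
theorem halts_fillRow {L d i₀ : ℕ} {e : RExpr} {σ : State} (hW : σ.nat 4 0 = d + 1)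
    (hL : d + 1 ≤ L) (hrow : σ.nat 7 (σ.nat 15 0) = i₀ * (d + 1)) (f : ℕ → ℝ)
    (he : ∀ l ≤ d, ∀ τ : State, (∀ a, a ≠ 14 → τ.nat a = σ.nat a) →
      (∀ a, a ≠ 2 → τ.real a = σ.real a) → τ.nat 14 0 = l →
      τ.real 2 (i₀ * (d + 1) + l) = σ.real 2 (i₀ * (d + 1) + l) → e.eval τ = f l) :
    Halts L (fillRow e) σ fun τ => ∀ i, ∀ l ≤ d, τ.real 2 (i * (d + 1) + l) =
      if i = i₀ then f l else σ.real 2 (i * (d + 1) + l) := by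
  refine Halts.forLoop (fun l τ => ∀ i, ∀ l' ≤ d, τ.real 2 (i * (d + 1) + l') =
    if i = i₀ ∧ l' < l then f l' else σ.real 2 (i * (d + 1) + l')) hW hL (by decide)
    (by simp [Prog.natWrites]) (by simp [Prog.natWrites]) (by simp) ?_ ?_
  · intro l hl τ hF hv hI
    have hn : ∀ a, a ≠ 14 → τ.nat a = σ.nat a := fun a ha =>
      hF.1 a (by simp [Prog.forLoop, Prog.natWrites, ha])
    have hr : ∀ a, a ≠ 2 → τ.real a = σ.real a := fun a ha =>
      hF.2 a (by simp [Prog.forLoop, Prog.realWrites, ha])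
    refine Halts.setReal fun i l' hl' => ?_
    have hval : e.eval τ = f l := he l (by omega) τ hn hr hv (by rw [hI _ _ (by omega)]; simp)
    have haddr : NExpr.eval τ (.add (.get 7 (.var 15)) (.var 14)) = i₀ * (d + 1) + l := by
      simp only [NExpr.eval, NExpr.eval_var, hn 7 (by decide), hn 15 (by decide), hrow, hv]
    simp only [haddr, hval, State.setNat_real, State.setReal_real_self,
      mul_add_inj (Nat.lt_succ_of_le hl') hl, hI i l' hl']
    by_cases h1 : i = i₀
    · by_cases h2 : l' = l
      · simp [h1, h2]
      · have : l' < l + 1 ↔ l' < l := by omega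
        simp [h1, h2, this]
    · simp [h1]
  · intro τ _ hI i l hl
    rw [hI i l hl]
    simp [Nat.lt_succ_of_le hl]

theorem halts_elimRow {L d n N k j a i₀ : ℕ} {σ₀ σ : State} (R : ℕ → ℕ → ℝ)
    (hσ : Ready d n N σ₀ σ) (hL : d + 1 ≤ L) (hk : k < d) (h20 : σ.nat 20 0 = k + 1)
    (h17 : σ.nat 17 0 = j) (h21 : σ.nat 21 0 = a) (hpiv : ∀ l ≤ d, σ.real 3 l = R j l)
    (h15 : σ.nat 15 0 = i₀) (hi₀ : i₀ ≤ N)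
    (hrow : ∀ l ≤ d, σ.real 2 (i₀ * (d + 1) + l) = R i₀ l) :
    Halts L elimRow σ fun τ => ∀ i, ∀ l ≤ d, τ.real 2 (i * (d + 1) + l) =
      if i = i₀ then reduceRows N k j a R i₀ l else σ.real 2 (i * (d + 1) + l) := by
  set r' : ℕ → ℝ := fun l => R i₀ l - R i₀ (k + 1) / R j (k + 1) * R j l with hr'
  refine Halts.seq (Halts.setReal (Halts.seq (Halts.setReal (Halts.seq ?_))))
  have e4 : RExpr.eval σ (.get 2 (.add (.get 7 (.var 15)) (.var 20))) = R i₀ (k + 1) := by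
    simp only [RExpr.eval, NExpr.eval, NExpr.eval_var, h15, h20, hσ.start _ hi₀]
    exact hrow _ (by omega)
  rw [e4]
  set σ₁ := σ.setReal 4 (NExpr.eval σ (.const 0)) (R i₀ (k + 1)) with hσ₁
  have e5 : RExpr.eval σ₁ (.div (.var 4) (.get 3 (.var 20))) =
      R i₀ (k + 1) / R j (k + 1) := by
    simp [RExpr.eval, NExpr.eval, hσ₁, h20, State.setReal_real_of_ne, hpiv _ hk]
  rw [e5]
  set σ₂ := σ₁.setReal 5 (NExpr.eval σ₁ (.const 0)) (R i₀ (k + 1) / R j (k + 1)) with hσ₂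
  have n2 : σ₂.nat = σ.nat := rfl
  have r24 : σ₂.real 4 0 = R i₀ (k + 1) := by
    simp [hσ₂, hσ₁, NExpr.eval, State.setReal_real_of_ne]
  have r25 : σ₂.real 5 0 = R i₀ (k + 1) / R j (k + 1) := by
    simp [hσ₂, NExpr.eval]
  have r23 : σ₂.real 3 = σ.real 3 := by simp [hσ₂, hσ₁, State.setReal_real_of_ne]
  have r22 : σ₂.real 2 = σ.real 2 := by simp [hσ₂, hσ₁, State.setReal_real_of_ne]
  refine (halts_fillRow (σ := σ₂) (i₀ := i₀) hσ.width hL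
    (by rw [n2, h15, hσ.start _ hi₀]) r' ?_).imp fun τ hF hτ => ?_
  · intro l hl τ hn hr hv hc
    simp only [RExpr.eval, NExpr.eval, NExpr.eval_var, RExpr.eval_var, hn 7 (by decide),
      hn 15 (by decide), hv, hr 5 (by decide), hr 3 (by decide), n2, h15, hσ.start _ hi₀, r23, r25,
      hpiv l hl, hc, r22, hrow l hl, hr']
  have hn : ∀ a, a ≠ 14 → τ.nat a = σ.nat a := fun a ha =>
    hF.1 a (by simp [fillRow, Prog.forLoop, Prog.natWrites, ha])
  have hτ4 : τ.real 4 0 = R i₀ (k + 1) := by rw [hF.2 4 (by decide), r24]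
  refine Halts.seq (Halts.setReal (Halts.seq ?_))
  refine Halts.forLoop (m := k + 1) (fun l υ => υ.real 6 0 = ∑ m ∈ Finset.range l, r' m * r' m)
    (by simp [hn 20 (by decide), h20]) (by omega) (by decide) (by decide) (by decide)
    (by simp [NExpr.eval, RExpr.eval]) ?_ ?_
  · intro l hl υ hFυ hv hI
    refine Halts.setReal ?_
    have : υ.real 2 (i₀ * (d + 1) + l) = r' l := by
      rw [hFυ.2 2 (by decide), State.setReal_real_of_ne _ _ _ (by decide), hτ i₀ l (by omega),
        if_pos rfl]
    have h7 : υ.nat 7 (υ.nat 15 0) = i₀ * (d + 1) := by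
      rw [hFυ.1 7 (by decide), hFυ.1 15 (by decide), State.setReal_nat, hn 7 (by decide),
        hn 15 (by decide), h15, hσ.start _ hi₀]
    simp [RExpr.eval, NExpr.eval, h7, hv, this, hI, Finset.sum_range_succ]
  · intro υ hFυ hI
    have hn' : ∀ a, a ≠ 14 → υ.nat a = σ.nat a := fun a ha => by
      rw [hFυ.1 a (by simp [Prog.forLoop, Prog.natWrites, ha]), State.setReal_nat, hn a ha]
    have h2 : υ.real 2 = τ.real 2 := by
      rw [hFυ.2 2 (by decide), State.setReal_real_of_ne _ _ _ (by decide)]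
    have h4 : υ.real 4 0 = R i₀ (k + 1) := by
      rw [hFυ.2 4 (by decide), State.setReal_real_of_ne _ _ _ (by decide), hτ4]
    have hcond : BExpr.Holds υ (.and (.natLt (.var 15) (.var 5))
        (.and (.realLt (.const 0) (.mul (.var 4) (.var 4)))
          (.not (.realLt (.const 0) (.var 6))))) ↔
        i₀ < N ∧ R i₀ (k + 1) ≠ 0 ∧
          ∀ m ≤ k, R i₀ m - R i₀ (k + 1) / R j (k + 1) * R j m = 0 := by
      simp only [BExpr.Holds, NExpr.eval_var, RExpr.eval, RExpr.eval_var, hn' 15 (by decide),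
        hn' 5 (by decide), h15, hσ.rows, h4, hI, Rat.cast_zero, not_lt]
      refine and_congr_right fun _ => and_congr ?_ ?_
      · rw [mul_self_pos]
      · have hnn : ∀ m ∈ Finset.range (k + 1), 0 ≤ r' m * r' m := fun m _ => mul_self_nonneg _
        have hz : ∑ m ∈ Finset.range (k + 1), r' m * r' m ≤ 0 ↔
            ∑ m ∈ Finset.range (k + 1), r' m * r' m = 0 :=
          ⟨fun h => le_antisymm h (Finset.sum_nonneg hnn), le_of_eq⟩
        rw [hz, Finset.sum_eq_zero_iff_of_nonneg hnn]
        simp [hr']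
    refine Halts.ite (fun hb => ?_) (fun hb => Halts.skip ?_)
    · have hb' := hcond.1 hb
      refine (halts_fillRow (σ := υ) (i₀ := i₀) (by rw [hn' 4 (by decide), hσ.width]) hL
        (by rw [hn' 7 (by decide), hn' 15 (by decide), h15, hσ.start _ hi₀])
        (reduceRows N k j a R i₀) ?_).imp fun ρ _ hρ i l hl => ?_
      · intro l hl ρ hρn hρr hv _
        simp only [RExpr.eval, NExpr.cast_eval_delta, NExpr.eval, NExpr.eval_var, RExpr.eval_var,
          hρn 15 (by decide), hρn 17 (by decide), hρn 21 (by decide), hn' 15 (by decide),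
          hn' 17 (by decide), hn' 21 (by decide), hρr 4 (by decide), h4, h15, h17, h21, hv,
          reduceRows, if_pos hb']
        by_cases hl0 : l = 0
        · by_cases hlt : i₀ < j + a
          · simp [hl0, hlt]; ring
          · have : 1 - (i₀ + 1 - (j + a)) = 0 := by omega
            simp [hl0, hlt, this]
        · simp [hl0]
      · rw [hρ i l hl, h2, hτ i l hl, r22]
        split_ifs <;> rfl
    · intro i l hl
      have hb' := fun h => hb (hcond.2 h)
      rw [h2, hτ i l hl, r22]
      simp only [reduceRows, if_neg hb', hr']

theorem halts_buildMatrix {L d n N : ℕ} {σ₀ σ : State} (hσ : Ready d n N σ₀ σ)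
    (hN : N = (n + 2) * (d + d)) (hL₁ : d + 1 ≤ L) (hL₂ : n + 2 ≤ L) (hL₃ : d + d ≤ L) :
    Halts L buildMatrix σ fun τ => ∀ i ≤ N, ∀ l ≤ d,
      τ.real 2 (i * (d + 1) + l) = initRows d n σ₀ i l := by
  refine Halts.seq (Halts.setNat (Halts.seq (Halts.setNat (Halts.seq ?_))))
  set σ₁ := (σ.setNat 15 _ _).setNat 16 _ _ with hσ₁
  have hR₁ : Ready d n N σ₀ σ₁ := hσ.congr (fun a ha => by
    rw [hσ₁, State.setNat_nat_of_ne _ _ _ (by omega), State.setNat_nat_of_ne _ _ _ (by omega)])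
    rfl rfl
  refine Halts.forLoop (m := n + 2) (fun g τ => τ.nat 15 0 = g * (d + d) ∧ τ.nat 16 0 = g * d ∧
    ∀ i < g * (d + d), ∀ l ≤ d, τ.real 2 (i * (d + 1) + l) = initRows d n σ₀ i l)
    hR₁.groups hL₂ (by decide) (by decide) (by decide) ?_ ?_ ?_
  · simp [hσ₁, NExpr.eval, State.setNat_nat_of_ne]
  · rintro g hg τ hF hv ⟨h15, h16, hmat⟩
    have hR : Ready d n N σ₀ τ := hR₁.frame hF (by decide) (by decide)
    refine Halts.seq (Halts.forLoop (m := d + d) (fun r υ => υ.nat 15 0 = g * (d + d) + r ∧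
      ∀ i < g * (d + d) + r, ∀ l ≤ d, υ.real 2 (i * (d + 1) + l) = initRows d n σ₀ i l)
      hR.groupSize hL₃ (by decide) (by decide) (by decide) ?_ ?_ ?_)
    · simpa [State.setNat_nat_of_ne, h15] using hmat
    · rintro r hr υ hFυ hvr ⟨hυ15, hυmat⟩
      have hRυ : Ready d n N σ₀ υ := hR.frame hFυ (by decide) (by decide)
      have hυg : υ.nat 12 0 = g := by rw [hFυ.1 12 (by decide), hv]
      have hυ16 : υ.nat 16 0 = g * d := by rw [hFυ.1 16 (by decide), h16]
      have hrowN : g * (d + d) + r < N := hN ▸ group_index_lt hg hr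
      have hjump : Halts L (.ite (.natLt (.var 13) (.var 0))
          (.seq (.setNat 17 (.const 0) (.var 13)) (.setNat 18 (.const 0) (.const 0)))
          (.seq (.setNat 17 (.const 0) (.sub (.var 13) (.var 0)))
          (.setNat 18 (.const 0) (.const 1)))) υ fun ω =>
          ω.nat 17 0 = (if r < d then r else r - d) ∧ ω.nat 18 0 = (if r < d then 0 else 1) := by
        refine Halts.ite (fun hb => ?_) (fun hb => ?_) <;>
          simp only [BExpr.Holds, NExpr.eval_var, hvr, hRυ.dim] at hb <;>
          refine Halts.seq (Halts.setNat (Halts.setNat ?_)) <;>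
          simp [NExpr.eval, State.setNat_nat_of_ne, hb, hvr, hRυ.dim]
      refine Halts.seq (hjump.imp fun ω hFω ⟨h17, h18⟩ => ?_)
      have hRω : Ready d n N σ₀ ω := hRυ.frame hFω (by decide) (by decide)
      have hω15 : ω.nat 15 0 = g * (d + d) + r := by rw [hFω.1 15 (by decide), hυ15]
      have hω12 : ω.nat 12 0 = g := by rw [hFω.1 12 (by decide), hυg]
      have hω16 : ω.nat 16 0 = g * d := by rw [hFω.1 16 (by decide), hυ16]
      have hstart : ω.nat 7 (ω.nat 15 0) = (g * (d + d) + r) * (d + 1) := by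
        rw [hω15, hRω.start _ hrowN.le]
      -- Both kinds of rows end with the same step to the next row.
      have hfinish : ∀ e : RExpr, (Halts L (fillRow e) ω fun ρ => ∀ i, ∀ l ≤ d,
          ρ.real 2 (i * (d + 1) + l) = if i = g * (d + d) + r then groupRow d n σ₀ g r l
            else ω.real 2 (i * (d + 1) + l)) →
          Halts L (fillRow e) ω fun ρ =>
            Halts L (.setNat 15 (.const 0) (.add (.var 15) (.const 1))) ρ fun τ' =>
              (τ'.setNat 13 0 (r + 1)).nat 15 0 = g * (d + d) + (r + 1) ∧
              ∀ i < g * (d + d) + (r + 1), ∀ l ≤ d,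
                (τ'.setNat 13 0 (r + 1)).real 2 (i * (d + 1) + l) = initRows d n σ₀ i l := by
        intro e he
        refine he.imp fun ρ hFρ hρ => Halts.setNat ⟨?_, fun i hi l hl => ?_⟩
        · have : ρ.nat 15 0 = ω.nat 15 0 := by
            rw [hFρ.1 15 (by simp [fillRow, Prog.forLoop, Prog.natWrites])]
          simp [NExpr.eval, State.setNat_nat_of_ne, this, hω15, add_assoc]
        · simp only [State.setNat_real]
          rw [hρ i l hl]
          split_ifs with h
          · rw [h, initRows_group σ₀ hg hr]
          · rw [hFω.2 2 (by decide), hυmat i (by omega) l hl]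
      refine Halts.seq (Halts.ite (fun hb => hfinish _ ?_) (fun hb => hfinish _ ?_))
      all_goals
        simp only [BExpr.Holds, NExpr.eval, NExpr.eval_var, hω12, hRω.num] at hb
        refine halts_fillRow hRω.width hL₁ hstart _ fun l hl ρ hρn hρr hρv _ => ?_
        simp [RExpr.eval, NExpr.cast_eval_delta, NExpr.eval, hρn 12 (by decide),
          hρn 16 (by decide), hρn 17 (by decide), hρn 18 (by decide), hρn 1 (by decide),
          hρn 2 (by decide), hρr 0 (by decide), hρv, hω12, hω16, h17, h18, hRω.dir, hRω.sign,
          hRω.apex, groupRow, hb]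
    · rintro υ hFυ ⟨hυ15, hυmat⟩
      refine Halts.setNat ⟨?_, ?_, ?_⟩
      · simp only [State.setNat_nat_of_ne _ _ _ (show 15 ≠ 12 by decide),
          State.setNat_nat_of_ne _ _ _ (show 15 ≠ 16 by decide), hυ15]
        ring
      · have h1 : υ.nat 0 0 = d := by rw [hFυ.1 0 (by decide), hR.dim]
        have h2 : υ.nat 16 0 = g * d := by rw [hFυ.1 16 (by decide), h16]
        simp only [State.setNat_nat_of_ne _ _ _ (show 16 ≠ 12 by decide), State.setNat_nat_self,
          NExpr.eval, NExpr.eval_var, h1, h2, if_true]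
        ring
      · simp only [State.setNat_real]
        intro i hi
        exact hυmat i (by rw [Nat.succ_mul] at hi; omega)
  · rintro τ hF ⟨h15, -, hmat⟩
    have hR : Ready d n N σ₀ τ := hR₁.frame hF (by decide) (by decide)
    rw [← hN] at h15 hmat
    refine (halts_fillRow (i₀ := N) hR.width hL₁ (by rw [h15, hR.start N le_rfl])
      (fun l => initRows d n σ₀ N l) fun l hl ρ hρn hρr hρv _ => ?_).imp fun ρ _ hρ i hi l hl => ?_
    · simp only [RExpr.eval, NExpr.eval_var, hρv, hρr 8 (by decide), hR.power l hl]
      rw [hN, initRows_objective]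
    · rw [hρ i l hl]
      split_ifs with h
      · rw [h]
      · exact hmat i (by omega) l hl

/-- The invariant of the elimination is that the accumulated weights, multiplied by the term of the
remaining flag for the current matrix, do not change. -/
theorem halts_eliminate {L d n N : ℕ} {σ₀ σ : State} (φ : Finset ℕ → ℝ) (R₀ : ℕ → ℕ → ℝ)
    (hσ : Ready d n N σ₀ σ) (hL₁ : d + 1 ≤ L) (hL₂ : N + 1 ≤ L)
    (hD : ∀ l < d, σ.nat 11 l < N + N)
    (hmat : ∀ i ≤ N, ∀ l ≤ d, σ.real 2 (i * (d + 1) + l) = R₀ i l) :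
    Halts L eliminate σ fun τ => ∃ R : ℕ → ℕ → ℝ,
      (∀ i ≤ N, ∀ l ≤ d, τ.real 2 (i * (d + 1) + l) = R i l) ∧
      τ.real 7 0 * flagTerm N φ (σ.nat 11) 0 d R =
        σ.real 7 0 * flagTerm N φ (σ.nat 11) d 0 R₀ := by
  refine Halts.forLoop (m := d) (fun u τ => ∃ R : ℕ → ℕ → ℝ,
      (∀ i ≤ N, ∀ l ≤ d, τ.real 2 (i * (d + 1) + l) = R i l) ∧
      τ.real 7 0 * flagTerm N φ (σ.nat 11) (d - u) u R =
        σ.real 7 0 * flagTerm N φ (σ.nat 11) d 0 R₀)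
    hσ.dim (by omega) (by decide) (by decide) (by decide) ⟨R₀, hmat, rfl⟩ ?_ ?_
  · rintro u hu τ hF hv ⟨R, hR, hterm⟩
    have hτ : Ready d n N σ₀ τ := hσ.frame hF (by decide) (by decide)
    have h11 : τ.nat 11 = σ.nat 11 := hF.1 11 (by decide)
    obtain ⟨k, hk⟩ : ∃ k, d - u = k + 1 := ⟨d - u - 1, by omega⟩
    have hkd : k < d := by omega
    set D := σ.nat 11 with hDdef
    set j := (if D k < N then D k else D k - N) with hj
    set a := (if D k < N then 0 else 1) with ha
    have hjN : j < N := by have := hD k hkd; rw [hj]; split_ifs <;> omega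
    refine Halts.seq (Halts.setNat (Halts.seq (Halts.setNat (Halts.seq (Halts.setNat
      (Halts.seq ?_))))))
    set τ₁ := ((τ.setNat 20 _ _).setNat 17 _ _).setNat 21 _ _ with hτ₁
    have hd₁ : τ₁.nat 20 0 = k + 1 ∧ τ₁.nat 17 0 = D k ∧ τ₁.nat 21 0 = 0 ∧ τ₁.nat 5 0 = N := by
      simp [hτ₁, NExpr.eval, State.setNat_nat_of_ne, hτ.dim, hv, hk, h11, hτ.rows]
    have hτ₁R : Ready d n N σ₀ τ₁ := hτ.congr (fun b hb => by
      rw [hτ₁, State.setNat_nat_of_ne _ _ _ (by omega), State.setNat_nat_of_ne _ _ _ (by omega),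
        State.setNat_nat_of_ne _ _ _ (by omega)]) rfl rfl
    have hτ₁r : τ₁.real = τ.real := rfl
    have hdig : Halts L (.ite (.natLt (.var 17) (.var 5)) .skip
        (.seq (.setNat 17 (.const 0) (.sub (.var 17) (.var 5)))
          (.setNat 21 (.const 0) (.const 1)))) τ₁ fun υ => υ.nat 17 0 = j ∧ υ.nat 21 0 = a := by
      refine Halts.ite (fun hb => Halts.skip ?_) (fun hb => Halts.seq (Halts.setNat
        (Halts.setNat ?_))) <;>
        simp only [BExpr.Holds, NExpr.eval_var, hd₁.2.1, hd₁.2.2.2] at hb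
      · simp [hd₁, hj, ha, hb]
      · simp [NExpr.eval, State.setNat_nat_of_ne, hd₁, hj, ha, hb]
    refine hdig.imp fun υ hFυ ⟨hυ17, hυ21⟩ => ?_
    have hυR : Ready d n N σ₀ υ := hτ₁R.frame hFυ (by decide) (by decide)
    have hυr : υ.real = τ.real := by
      funext b; rw [hFυ.2 b (by simp [Prog.realWrites]), hτ₁r]
    have hυ20 : υ.nat 20 0 = k + 1 := by rw [hFυ.1 20 (by decide), hd₁.1]
    refine Halts.seq (Halts.forLoop (m := d + 1) (fun l ω => ∀ l' < l, ω.real 3 l' = R j l')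
      hυR.width hL₁ (by decide) (by decide) (by decide) (by simp) ?_ ?_)
    · intro l hl ω hFω hvω hI
      refine Halts.setReal fun l' hl' => ?_
      have h7 : ω.nat 7 (ω.nat 17 0) = j * (d + 1) := by
        rw [hFω.1 7 (by decide), hFω.1 17 (by decide), hυ17, hυR.start _ hjN.le]
      have h2 : ω.real 2 (j * (d + 1) + l) = R j l := by
        rw [hFω.2 2 (by decide), hυr, hR j hjN.le l (by omega)]
      simp only [State.setNat_real, State.setReal_real_self, NExpr.eval, NExpr.eval_var,
        RExpr.eval, h7, hvω, h2]
      split_ifs with h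
      · rw [h]
      · exact hI l' (by omega)
    · intro ω hFω hpiv
      have hωR : Ready d n N σ₀ ω := hυR.frame hFω (by decide) (by decide)
      have hω2 : ω.real 2 = τ.real 2 := by rw [hFω.2 2 (by decide), hυr]
      have hω7 : ω.real 7 = τ.real 7 := by rw [hFω.2 7 (by decide), hυr]
      have hω20 : ω.nat 20 0 = k + 1 := by rw [hFω.1 20 (by decide), hυ20]
      have hω17 : ω.nat 17 0 = j := by rw [hFω.1 17 (by decide), hυ17]
      have hω21 : ω.nat 21 0 = a := by rw [hFω.1 21 (by decide), hυ21]
      refine Halts.seq (Halts.setReal ?_)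
      have hweight : RExpr.eval ω (.mul (.var 7) <|
          .div (.mul (.sub (.const 1) (.mul (.const 2) (.ofNat (.var 21))))
            (.div (.get 3 (.var 20)) (.get 3 (.var 20))))
            (.get 2 (.add (.get 7 (.var 5)) (.var 20)))) =
          τ.real 7 0 * pivotWeight N k j a R := by
        simp [RExpr.eval, NExpr.eval, hω20, hω21, hωR.rows, hωR.start N le_rfl,
          hpiv (k + 1) (by omega), hω2, hω7, hR N le_rfl (k + 1) (by omega), pivotWeight]
      rw [hweight]
      set ω₁ := ω.setReal 7 _ (τ.real 7 0 * pivotWeight N k j a R) with hω₁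
      have hω₁7 : ω₁.real 7 0 = τ.real 7 0 * pivotWeight N k j a R := by
        simp [hω₁, NExpr.eval]
      have hω₁R : Ready d n N σ₀ ω₁ := hωR.congr (fun _ _ => rfl)
        (State.setReal_real_of_ne _ _ _ (by decide)) (State.setReal_real_of_ne _ _ _ (by decide))
      refine Halts.forLoop (m := N + 1) (fun i ρ => ∀ i' ≤ N, ∀ l ≤ d,
          ρ.real 2 (i' * (d + 1) + l) = if i' < i then reduceRows N k j a R i' l else R i' l)
        hω₁R.rows_succ hL₂ (by decide) (by decide) (by decide) ?_ ?_ ?_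
      · intro i' hi' l hl
        rw [State.setNat_real, hω₁, State.setReal_real_of_ne _ _ _ (by decide), hω2,
          hR i' hi' l hl, if_neg (Nat.not_lt_zero _)]
      · intro i hi ρ hFρ hvρ hI
        have hρR : Ready d n N σ₀ ρ := hω₁R.frame hFρ (by decide) (by decide)
        refine (halts_elimRow R hρR hL₁ hkd (j := j) (a := a) (i₀ := i) ?_ ?_ ?_ ?_ hvρ (by omega)
          ?_).imp fun χ _ hχ i' hi' l hl => ?_
        · rw [hFρ.1 20 (by decide)]; exact hω20
        · rw [hFρ.1 17 (by decide)]; exact hω17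
        · rw [hFρ.1 21 (by decide)]; exact hω21
        · intro l hl
          rw [hFρ.2 3 (by decide), hω₁, State.setReal_real_of_ne _ _ _ (by decide),
            hpiv l (by omega)]
        · intro l hl
          rw [hI i (by omega) l hl, if_neg (lt_irrefl i)]
        · rw [State.setNat_real, hχ i' l hl, hI i' hi' l hl]
          by_cases h : i' = i
          · simp [h]
          · have : i' < i + 1 ↔ i' < i := by omega
            simp [h, this]
      · intro ρ hFρ hI
        refine ⟨reduceRows N k j a R, fun i hi l hl => ?_, ?_⟩
        · rw [State.setNat_real, hI i hi l hl, if_pos (Nat.lt_succ_of_le hi)]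
        · rw [State.setNat_real, hFρ.2 7 (by decide), hω₁7, ← hterm, hk,
            show d - (u + 1) = k by omega]
          simp only [flagTerm, ← hj, ← ha, mul_assoc]
  · rintro τ _ ⟨R, hR, hterm⟩
    rw [Nat.sub_self] at hterm
    exact ⟨R, hR, hterm⟩

open Classical in
theorem halts_checkGroups {L d n N : ℕ} {σ₀ σ : State} (R : ℕ → ℕ → ℝ)
    (hσ : Ready d n N σ₀ σ) (hN : N = (n + 2) * (d + d)) (hL₂ : n + 2 ≤ L) (hL₃ : d + d ≤ L)
    (hmat : ∀ i < N, σ.real 2 (i * (d + 1)) = R i 0) :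
    Halts L checkGroups σ fun τ => τ.real 7 0 = σ.real 7 0 *
      spaceIndicator d n ((Finset.range N).filter fun i => R i 0 < 0) := by
  set T := (Finset.range N).filter fun i => R i 0 < 0 with hT
  refine Halts.seq (Halts.setNat ?_)
  have hR₁ : Ready d n N σ₀ (σ.setNat 15 (NExpr.eval σ (.const 0)) (NExpr.eval σ (.const 0))) :=
    hσ.congr (fun a ha => State.setNat_nat_of_ne _ _ _ (by omega)) rfl rfl
  refine Halts.forLoop (m := n + 2) (fun g τ => τ.nat 15 0 = g * (d + d) ∧
    τ.real 7 0 = σ.real 7 0 * ∏ g ∈ Finset.range g, if g < n then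
      (if GroupViolated d T g then 1 else 0) else 1 - (if GroupViolated d T g then 1 else 0))
    hR₁.groups hL₂ (by decide) (by decide) (by decide) ?_ ?_ ?_
  · simp [NExpr.eval, State.setNat_nat_of_ne]
  · rintro g hg τ hF hv ⟨h15, h7⟩
    have hR : Ready d n N σ₀ τ := hR₁.frame hF (by decide) (by decide)
    have h2 : τ.real 2 = σ.real 2 := by rw [hF.2 2 (by decide)]; rfl
    refine Halts.seq (Halts.setNat (Halts.seq ?_))
    have hR₂ : Ready d n N σ₀ (τ.setNat 22 (NExpr.eval τ (.const 0)) (NExpr.eval τ (.const 0))) :=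
      hR.congr (fun a ha => State.setNat_nat_of_ne _ _ _ (by omega)) rfl rfl
    refine Halts.forLoop (m := d + d) (fun r υ => υ.nat 15 0 = g * (d + d) + r ∧
      υ.nat 22 0 = if ∃ r' < r, g * (d + d) + r' ∈ T then 1 else 0)
      hR₂.groupSize hL₃ (by decide) (by decide) (by decide) ?_ ?_ ?_
    · simp [NExpr.eval, State.setNat_nat_of_ne, h15]
    · rintro r hr υ hFυ hvr ⟨hυ15, hυ22⟩
      have hRυ : Ready d n N σ₀ υ := hR₂.frame hFυ (by decide) (by decide)
      have hrowN : g * (d + d) + r < N := hN ▸ group_index_lt hg hr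
      have hcell : RExpr.eval υ (.get 2 (.get 7 (.var 15))) = R (g * (d + d) + r) 0 := by
        simp only [RExpr.eval, NExpr.eval, NExpr.eval_var, hυ15, hRυ.start _ hrowN.le]
        rw [hFυ.2 2 (by decide), State.setNat_real, h2, hmat _ hrowN]
      have hmem : g * (d + d) + r ∈ T ↔ R (g * (d + d) + r) 0 < 0 := by
        simp [hT, hrowN]
      have hex : (∃ r' < r + 1, g * (d + d) + r' ∈ T) ↔
          (∃ r' < r, g * (d + d) + r' ∈ T) ∨ g * (d + d) + r ∈ T := by
        simp only [Nat.lt_succ_iff_lt_or_eq, or_and_right, exists_or, exists_eq_left]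
      have hcond : BExpr.Holds υ (.realLt (.get 2 (.get 7 (.var 15))) (.const 0)) ↔
          g * (d + d) + r ∈ T := by
        rw [hmem, ← hcell]
        simp [BExpr.Holds, RExpr.eval]
      refine Halts.seq (Halts.ite (fun hb => Halts.setNat ?_) (fun hb => Halts.skip ?_)) <;>
        rw [hcond] at hb
      · refine Halts.setNat ⟨?_, ?_⟩
        · simp [NExpr.eval, State.setNat_nat_of_ne, hυ15, add_assoc]
        · rw [if_pos (hex.2 (Or.inr hb))]
          simp [NExpr.eval, State.setNat_nat_of_ne]
      · refine Halts.setNat ⟨?_, ?_⟩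
        · simp [NExpr.eval, State.setNat_nat_of_ne, hυ15, add_assoc]
        · simp only [hex, hb, or_false]
          simp [State.setNat_nat_of_ne, hυ22]
    · rintro υ hFυ ⟨hυ15, hυ22⟩
      have hR' : Ready d n N σ₀ υ := hR₂.frame hFυ (by decide) (by decide)
      have hυg : υ.nat 12 0 = g := by
        rw [hFυ.1 12 (by decide), State.setNat_nat_of_ne _ _ _ (by decide), hv]
      have hυ7 : υ.real 7 0 = τ.real 7 0 := by rw [hFυ.2 7 (by decide)]; rfl
      have hυ22' : (υ.nat 22 0 : ℝ) = if GroupViolated d T g then 1 else 0 := by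
        rw [hυ22]; unfold GroupViolated; split_ifs <;> simp
      refine Halts.ite (fun hb => Halts.setReal ⟨?_, ?_⟩) (fun hb => Halts.setReal ⟨?_, ?_⟩) <;>
        simp only [BExpr.Holds, NExpr.eval, NExpr.eval_var, hυg, hR'.num] at hb
      · simp only [State.setNat_nat_of_ne _ _ _ (show 15 ≠ 12 by decide), State.setReal_nat, hυ15]
        ring
      · simp only [State.setNat_real, State.setReal_real_self, NExpr.eval, if_true, RExpr.eval,
          RExpr.eval_var, NExpr.eval_var, hυ22', hυ7, h7, Finset.prod_range_succ, if_pos hb]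
        ring
      · simp only [State.setNat_nat_of_ne _ _ _ (show 15 ≠ 12 by decide), State.setReal_nat, hυ15]
        ring
      · simp only [State.setNat_real, State.setReal_real_self, NExpr.eval, if_true, RExpr.eval,
          RExpr.eval_var, NExpr.eval_var, hυ22', hυ7, h7, Finset.prod_range_succ, if_neg hb,
          Rat.cast_one]
        ring
  · rintro τ _ ⟨_, h⟩
    exact h

theorem halts_multiplyPower {L d n N : ℕ} {σ₀ σ : State} {c : ℝ}
    (hσ : Ready d n N σ₀ σ) (hL₁ : d ≤ L) (hc : σ.real 2 (N * (d + 1)) = c) :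
    Halts L multiplyPower σ fun τ =>
      τ.real 7 0 = σ.real 7 0 * (c ^ d / (d.factorial : ℝ)) := by
  refine Halts.forLoop (m := d)
    (fun l τ => τ.real 7 0 = σ.real 7 0 * (c ^ l / (l.factorial : ℝ)))
    hσ.dim hL₁ (by decide) (by decide) (by decide) (by simp) ?_ fun _ _ h => h
  intro l hl τ hF hv hI
  refine Halts.setReal ?_
  have hR : Ready d n N σ₀ τ := hσ.frame hF (by decide) (by decide)
  have h2 : τ.real 2 (N * (d + 1)) = c := by rw [hF.2 2 (by decide), hc]
  simp only [State.setNat_real, State.setReal_real_self, NExpr.eval, if_true, RExpr.eval,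
    RExpr.eval_var, NExpr.eval_var, hR.rows, hR.start N le_rfl, h2, hI, hv]
  have : (l.factorial : ℝ) ≠ 0 := by positivity
  rw [Nat.factorial_succ]
  push_cast
  field_simp
  ring

theorem halts_addFlagTerm {L d n N : ℕ} {σ₀ σ : State} (hσ : Ready d n N σ₀ σ)
    (hN : N = (n + 2) * (d + d)) (hL₁ : d + 1 ≤ L) (hL₂ : n + 2 ≤ L) (hL₃ : d + d ≤ L)
    (hL₄ : N + 1 ≤ L) (hD : ∀ l < d, σ.nat 11 l < N + N) :
    Halts L addFlagTerm σ fun τ => τ.real 1 0 = σ.real 1 0 +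
      flagTerm N (spaceIndicator d n) (σ.nat 11) d 0 (initRows d n σ₀) := by
  refine Halts.seq (Halts.setReal (Halts.seq ?_))
  set σ₁ := σ.setReal 7 _ _ with hσ₁
  have h₁ : Ready d n N σ₀ σ₁ := hσ.congr (fun _ _ => rfl)
    (State.setReal_real_of_ne _ _ _ (by decide)) (State.setReal_real_of_ne _ _ _ (by decide))
  have hw₁ : σ₁.real 7 0 = 1 := by simp [hσ₁, NExpr.eval, RExpr.eval]
  have ho₁ : σ₁.real 1 = σ.real 1 := State.setReal_real_of_ne _ _ _ (by decide)
  refine (halts_buildMatrix h₁ hN hL₁ hL₂ hL₃).imp fun σ₂ hF₂ hmat₂ => Halts.seq ?_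
  have h₂ : Ready d n N σ₀ σ₂ := h₁.frame hF₂ (by decide) (by decide)
  have hD₂ : σ₂.nat 11 = σ.nat 11 := by rw [hF₂.1 11 (by decide)]; rfl
  refine (halts_eliminate (spaceIndicator d n) (initRows d n σ₀) h₂ hL₁ hL₄
    (by rwa [hD₂]) hmat₂).imp fun σ₃ hF₃ ⟨R, hmat₃, hterm⟩ => Halts.seq ?_
  have h₃ : Ready d n N σ₀ σ₃ := h₂.frame hF₃ (by decide) (by decide)
  rw [hF₂.2 7 (by decide), hw₁, one_mul, hD₂] at hterm
  refine (halts_checkGroups R h₃ hN hL₂ hL₃ fun i hi => hmat₃ i hi.le 0 (Nat.zero_le d)).imp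
    fun σ₄ hF₄ hw₄ => Halts.seq ?_
  have h₄ : Ready d n N σ₀ σ₄ := h₃.frame hF₄ (by decide) (by decide)
  refine (halts_multiplyPower (c := R N 0) h₄ (by omega) ?_).imp fun σ₅ hF₅ hw₅ =>
    Halts.setReal ?_
  · rw [hF₄.2 2 (by decide)]
    exact hmat₃ N le_rfl 0 (Nat.zero_le d)
  · have ho : σ₅.real 1 0 = σ.real 1 0 := by
      rw [hF₅.2 1 (by decide), hF₄.2 1 (by decide), hF₃.2 1 (by decide), hF₂.2 1 (by decide), ho₁]
    simp only [State.setReal_real_self, NExpr.eval, if_true, RExpr.eval, RExpr.eval_var, ho]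
    rw [← hterm, hw₅, hw₄]
    simp only [flagTerm, mul_assoc]

/-- The invariant after the digits below `k` have been treated is that these digits are those of
`x + 1`, and that there is a carry if and only if they have all been reset to `0`, that is,
`B ^ k ∣ x + 1`. -/
theorem halts_increment {L d n N x : ℕ} {σ₀ σ : State} (hσ : Ready d n N σ₀ σ) (hN : 0 < N)
    (hL : d ≤ L) (hx : x < (N + N) ^ d) (hD : ∀ l < d, σ.nat 11 l = x / (N + N) ^ l % (N + N)) :
    Halts L increment σ fun τ =>
      (τ.nat 10 0 = if x + 1 = (N + N) ^ d then 1 else 0) ∧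
      ∀ l < d, τ.nat 11 l = (x + 1) / (N + N) ^ l % (N + N) := by
  set B := N + N with hB
  have hB1 : 1 < B := by omega
  refine Halts.seq (Halts.setNat ?_)
  have hR₁ : Ready d n N σ₀ (σ.setNat 10 (NExpr.eval σ (.const 0)) (NExpr.eval σ (.const 1))) :=
    hσ.congr (fun a ha => State.setNat_nat_of_ne _ _ _ (by omega)) rfl rfl
  refine Halts.forLoop (m := d) (fun k τ => (τ.nat 10 0 = if B ^ k ∣ x + 1 then 1 else 0) ∧
    (∀ l < k, τ.nat 11 l = (x + 1) / B ^ l % B) ∧ ∀ l < d, k ≤ l → τ.nat 11 l = x / B ^ l % B)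
    hR₁.dim hL (by decide) (by decide) (by decide) ?_ ?_ ?_
  · simp [NExpr.eval, State.setNat_nat_of_ne]
    exact hD
  · rintro k hk τ hF hv ⟨hc, hlow, hhigh⟩
    have hR : Ready d n N σ₀ τ := hR₁.frame hF (by decide) (by decide)
    have hdig : τ.nat 11 k = x / B ^ k % B := hhigh k hk le_rfl
    have hdiv : (x + 1) / B ^ k = x / B ^ k + if B ^ k ∣ x + 1 then 1 else 0 := Nat.succ_div
    have hlow' : ∀ (υ : State) (w : ℕ), (∀ l, υ.nat 11 l = if l = k then w else τ.nat 11 l) →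
        w = (x + 1) / B ^ k % B →
        (∀ l < k + 1, υ.nat 11 l = (x + 1) / B ^ l % B) ∧
          ∀ l < d, k + 1 ≤ l → υ.nat 11 l = x / B ^ l % B := by
      intro υ w hυ hw
      refine ⟨fun l hl => ?_, fun l hl hkl => ?_⟩
      · rw [hυ]
        split_ifs with h
        · rw [hw, h]
        · exact hlow l (by omega)
      · rw [hυ, if_neg (by omega)]
        exact hhigh l hl (by omega)
    have hdvd : B ^ (k + 1) ∣ x + 1 ↔ B ^ k ∣ x + 1 ∧ (x + 1) / B ^ k % B = 0 := by
      rw [pow_succ]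
      constructor
      · rintro ⟨q, hq⟩
        refine ⟨⟨B * q, by rw [hq]; ring⟩, ?_⟩
        rw [hq, mul_assoc, Nat.mul_div_cancel_left _ (by positivity), Nat.mul_mod_right]
      · rintro ⟨⟨q, hq⟩, h⟩
        rw [hq, Nat.mul_div_cancel_left _ (by positivity)] at h
        rw [hq]
        exact Nat.mul_dvd_mul_left _ (Nat.dvd_of_mod_eq_zero h)
    refine Halts.ite (fun hb => Halts.ite (fun hb' => Halts.seq (Halts.setNat (Halts.setNat ?_)))
      fun hb' => Halts.setNat ?_) fun hb => Halts.skip ?_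
    · have hcar : B ^ k ∣ x + 1 := by
        by_contra h
        simp [BExpr.Holds, NExpr.eval, hc, h] at hb
      rw [if_pos hcar] at hdiv
      simp only [BExpr.Holds, NExpr.eval, NExpr.eval_var, hv, hdig, hR.base] at hb'
      have hnew : (x + 1) / B ^ k % B = x / B ^ k % B + 1 := by
        rw [hdiv, Nat.add_mod, Nat.mod_eq_of_lt hB1, Nat.mod_eq_of_lt hb']
      refine ⟨?_, hlow' _ (x / B ^ k % B + 1) (fun l => ?_) hnew.symm⟩
      · rw [if_neg (by rw [hdvd, hnew]; omega)]
        simp [NExpr.eval, State.setNat_nat_of_ne]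
      · simp [NExpr.eval, State.setNat_nat_of_ne, hv, hdig]
    · have hcar : B ^ k ∣ x + 1 := by
        by_contra h
        simp [BExpr.Holds, NExpr.eval, hc, h] at hb
      rw [if_pos hcar] at hdiv
      simp only [BExpr.Holds, NExpr.eval, NExpr.eval_var, hv, hdig, hR.base] at hb'
      have hnew : (x + 1) / B ^ k % B = 0 := by
        have hlt := Nat.mod_lt (x / B ^ k) (show 0 < B by omega)
        have heq : x / B ^ k % B + 1 = B := by omega
        rw [hdiv, Nat.add_mod, Nat.mod_eq_of_lt hB1, heq, Nat.mod_self]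
      refine ⟨?_, hlow' _ 0 (fun l => ?_) hnew.symm⟩
      · rw [if_pos (hdvd.2 ⟨hcar, hnew⟩)]
        simp [NExpr.eval, State.setNat_nat_of_ne, hc, hcar]
      · simp [NExpr.eval, State.setNat_nat_of_ne, hv]
    · have hcar : ¬ B ^ k ∣ x + 1 := by
        intro h
        simp [BExpr.Holds, NExpr.eval, hc, h] at hb
      rw [if_neg hcar, add_zero] at hdiv
      refine ⟨?_, hlow' _ (τ.nat 11 k) (fun l => ?_) (by rw [hdig, ← hdiv])⟩
      · rw [if_neg (by rw [hdvd]; tauto)]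
        simp [State.setNat_nat_of_ne, hc, hcar]
      · simp only [State.setNat_nat_of_ne _ _ _ (show 11 ≠ 14 by decide)]
        split_ifs with h
        · rw [h]
        · rfl
  · rintro τ _ ⟨hc, hlow, -⟩
    refine ⟨?_, hlow⟩
    rw [hc]
    have : B ^ d ∣ x + 1 ↔ x + 1 = B ^ d :=
      ⟨fun h => le_antisymm hx (Nat.le_of_dvd (Nat.succ_pos x) h), fun h => h ▸ dvd_rfl⟩
    simp only [this]

theorem halts_prepare {L d n N : ℕ} {σ₀ : State} (hN : N = (n + 2) * (d + d))
    (h0 : σ₀.nat 0 0 = d) (h1 : σ₀.nat 0 1 = n) (h5 : σ₀.nat 5 0 = 0) (h7 : σ₀.nat 7 0 = 0)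
    (hL₁ : d ≤ L) (hL₂ : n + 2 ≤ L) (hL₃ : N ≤ L) :
    Halts L prepare σ₀ (Ready d n N σ₀) := by
  refine Halts.seq (Halts.setNat (Halts.seq (Halts.setNat (Halts.seq (Halts.setNat
    (Halts.seq ?_))))))
  set σ₁ := ((σ₀.setNat 3 _ _).setNat 4 _ _).setNat 8 _ _ with hσ₁
  have hr₁ : σ₁.real = σ₀.real := rfl
  have n₁ : σ₁.nat 3 0 = d + d ∧ σ₁.nat 4 0 = d + 1 ∧ σ₁.nat 8 0 = n + 2 := by
    simp [hσ₁, NExpr.eval, State.setNat_nat_of_ne, h0, h1]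
  have k₁ : ∀ a, a ≠ 3 → a ≠ 4 → a ≠ 8 → σ₁.nat a = σ₀.nat a := by
    intro a h3 h4 h8
    rw [hσ₁, State.setNat_nat_of_ne _ _ _ h8, State.setNat_nat_of_ne _ _ _ h4,
      State.setNat_nat_of_ne _ _ _ h3]
  refine Halts.forLoop (m := n + 2) (fun g τ => τ.nat 5 0 = g * (d + d)) n₁.2.2 hL₂ (by decide)
    (by decide) (by decide) ?_ ?_ ?_
  · rw [State.setNat_nat_of_ne _ _ _ (by decide), k₁ 5 (by decide) (by decide) (by decide), h5,
      zero_mul]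
  · intro g _ τ hF _ hI
    refine Halts.setNat ?_
    have : τ.nat 3 0 = d + d := by rw [hF.1 3 (by decide), n₁.1]
    simp [NExpr.eval, State.setNat_nat_of_ne, hI, this, Nat.succ_mul]
  intro σ₂ hF₂ h₂
  rw [← hN] at h₂
  refine Halts.seq (Halts.setNat (Halts.seq (Halts.setNat (Halts.seq ?_))))
  set σ₃ := (σ₂.setNat 6 _ _).setNat 9 _ _ with hσ₃
  have n₃ : σ₃.nat 6 0 = N + N ∧ σ₃.nat 9 0 = N + 1 := by
    simp [hσ₃, NExpr.eval, State.setNat_nat_of_ne, h₂]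
  have k₃ : ∀ a, a ≠ 6 → a ≠ 9 → a ≠ 5 → a ≠ 12 → σ₃.nat a = σ₁.nat a := by
    intro a h6 h9 h5 h12
    rw [hσ₃, State.setNat_nat_of_ne _ _ _ h9, State.setNat_nat_of_ne _ _ _ h6,
      hF₂.1 a (by simp [Prog.forLoop, Prog.natWrites, h5, h12])]
  have n₃5 : σ₃.nat 5 0 = N := by simp [hσ₃, State.setNat_nat_of_ne, h₂]
  have r₃ : σ₃.real = σ₀.real := by
    funext b; rw [← hr₁, ← hF₂.2 b (by simp [Prog.forLoop, Prog.realWrites])]; rfl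
  refine Halts.forLoop (m := N) (fun i τ => ∀ i' ≤ i, τ.nat 7 i' = i' * (d + 1)) n₃5 hL₃
    (by decide) (by decide) (by decide) ?_ ?_ ?_
  · intro i' hi'
    obtain rfl : i' = 0 := by omega
    rw [State.setNat_nat_of_ne _ _ _ (by decide), k₃ 7 (by decide) (by decide) (by decide)
      (by decide), k₁ 7 (by decide) (by decide) (by decide), h7, zero_mul]
  · intro i _ τ hF hv hI
    refine Halts.setNat fun i' hi' => ?_
    have : τ.nat 4 0 = d + 1 := by
      rw [hF.1 4 (by decide), k₃ 4 (by decide) (by decide) (by decide) (by decide), n₁.2.1]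
    rw [State.setNat_nat_of_ne _ _ _ (by decide)]
    simp only [State.setNat_nat_self, NExpr.eval, NExpr.eval_var, hv, hI i le_rfl, this]
    split_ifs with h
    · rw [h]; ring
    · exact hI i' (by omega)
  intro σ₄ hF₄ h₄
  have k₄ : ∀ a, a ≠ 7 → a ≠ 15 → σ₄.nat a = σ₃.nat a := fun a h7 h15 =>
    hF₄.1 a (by simp [Prog.forLoop, Prog.natWrites, h7, h15])
  have r₄ : σ₄.real = σ₀.real := by
    funext b; rw [← r₃, hF₄.2 b (by simp [Prog.forLoop, Prog.realWrites])]
  refine Halts.seq (Halts.setReal ?_)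
  have c₄ : ∀ a, a ≠ 3 → a ≠ 4 → a ≠ 5 → a ≠ 6 → a ≠ 7 → a ≠ 8 → a ≠ 9 → a ≠ 12 → a ≠ 15 →
      σ₄.nat a = σ₀.nat a := fun a h3 h4 h5 h6 h7 h8 h9 h12 h15 => by
    rw [k₄ a h7 h15, k₃ a h6 h9 h5 h12, k₁ a h3 h4 h8]
  have hd : σ₄.nat 0 0 = d := by
    rw [c₄ 0 (by decide) (by decide) (by decide) (by decide) (by decide) (by decide) (by decide)
      (by decide) (by decide), h0]
  refine Halts.forLoop (m := d) (fun l τ => ∀ l' ≤ l, τ.real 8 l' = 2 ^ l') hd hL₁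
    (by decide) (by decide) (by decide) ?_ ?_ ?_
  · intro l' hl'
    obtain rfl : l' = 0 := by omega
    simp [NExpr.eval, RExpr.eval]
  · intro l _ τ hF hv hI
    refine Halts.setReal fun l' hl' => ?_
    simp only [State.setNat_real, State.setReal_real_self, NExpr.eval, NExpr.eval_var, RExpr.eval,
      hv, hI l le_rfl]
    split_ifs with h
    · rw [h]; ring
    · exact hI l' (by omega)
  intro τ hF hpow
  have c : ∀ a, a ≠ 14 → τ.nat a = σ₄.nat a := fun a h14 =>
    hF.1 a (by simp [Prog.forLoop, Prog.natWrites, h14])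
  constructor
  · rw [c 0 (by decide), hd]
  · rw [c 0 (by decide), c₄ 0 (by decide) (by decide) (by decide) (by decide) (by decide)
      (by decide) (by decide) (by decide) (by decide), h1]
  · rw [c 1 (by decide), c₄ 1 (by decide) (by decide) (by decide) (by decide) (by decide)
      (by decide) (by decide) (by decide) (by decide)]
  · rw [c 2 (by decide), c₄ 2 (by decide) (by decide) (by decide) (by decide) (by decide)
      (by decide) (by decide) (by decide) (by decide)]
  · rw [hF.2 0 (by decide), State.setReal_real_of_ne _ _ _ (by decide), r₄]
  · rw [c 3 (by decide), k₄ 3 (by decide) (by decide), k₃ 3 (by decide) (by decide) (by decide)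
      (by decide), n₁.1]
  · rw [c 4 (by decide), k₄ 4 (by decide) (by decide), k₃ 4 (by decide) (by decide) (by decide)
      (by decide), n₁.2.1]
  · rw [c 5 (by decide), k₄ 5 (by decide) (by decide), n₃5]
  · rw [c 6 (by decide), k₄ 6 (by decide) (by decide), n₃.1]
  · intro i hi
    rw [c 7 (by decide), h₄ i hi]
  · rw [c 8 (by decide), k₄ 8 (by decide) (by decide), k₃ 8 (by decide) (by decide) (by decide)
      (by decide), n₁.2.2]
  · rw [c 9 (by decide), k₄ 9 (by decide) (by decide), n₃.2]
  · exact hpow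

/-- The loop over all digit vectors, started at the number `x`, performs `(N + N) ^ d - x`
rounds. -/
theorem runs_sumFlags {L d n N : ℕ} {σ₀ : State} (hN : N = (n + 2) * (d + d)) (hN0 : 0 < N)
    (hL₁ : d + 1 ≤ L) (hL₂ : n + 2 ≤ L) (hL₃ : d + d ≤ L) (hL₄ : N + 1 ≤ L) (r : ℕ) :
    ∀ (x : ℕ) (σ : State), x + r = (N + N) ^ d → Ready d n N σ₀ σ →
      (σ.nat 10 0 = if x = (N + N) ^ d then 1 else 0) →
      (∀ l < d, σ.nat 11 l = x / (N + N) ^ l % (N + N)) →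
      ∃ t τ, Runs sumFlags σ t τ ∧
        t ≤ r * ((Prog.seq addFlagTerm increment).budget L + 6) + 6 ∧
        τ.real 1 0 = σ.real 1 0 + ∑ y ∈ Finset.range r, flagTerm N (spaceIndicator d n)
          (fun l => (x + y) / (N + N) ^ l % (N + N)) d 0 (initRows d n σ₀) := by
  have holds : ∀ σ : State, BExpr.Holds σ (.natLt (.var 10) (.const 1)) ↔ σ.nat 10 0 < 1 :=
    fun σ => Iff.rfl
  have hcost : BExpr.cost (.natLt (.var 10) (.const 1)) = 4 := rfl
  induction r with
  | zero =>
    intro x σ hx _ hc _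
    refine ⟨_, σ, Runs.loop_stop ?_, by rw [hcost]; omega, by simp⟩
    rw [holds, hc, if_pos (by omega)]
    omega
  | succ r ih =>
    intro x σ hx hσ hc hD
    have hxlt : x < (N + N) ^ d := by omega
    have hround : Halts L (.seq addFlagTerm increment) σ fun τ =>
        Ready d n N σ₀ τ ∧ (τ.nat 10 0 = if x + 1 = (N + N) ^ d then 1 else 0) ∧
        (∀ l < d, τ.nat 11 l = (x + 1) / (N + N) ^ l % (N + N)) ∧
        τ.real 1 0 = σ.real 1 0 + flagTerm N (spaceIndicator d n)
          (fun l => x / (N + N) ^ l % (N + N)) d 0 (initRows d n σ₀) := by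
      refine Halts.seq ((halts_addFlagTerm hσ hN hL₁ hL₂ hL₃ hL₄ fun l hl => ?_).imp
        fun τ hF hτ => ?_)
      · rw [hD l hl]
        exact Nat.mod_lt _ (by omega)
      · have hτR : Ready d n N σ₀ τ := hσ.frame hF (by decide) (by decide)
        refine (halts_increment hτR hN0 (by omega) hxlt fun l hl => ?_).imp
          fun υ hFυ ⟨hc', hD'⟩ => ⟨hτR.frame hFυ (by decide) (by decide), hc', hD', ?_⟩
        · rw [hF.1 11 (by decide), hD l hl]
        · rw [hFυ.2 1 (by decide), hτ, flagTerm_congr hD]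
    obtain ⟨t, τ, hr, ht, hτR, hc', hD', ho⟩ := hround
    obtain ⟨t', τ', hr', ht', ho'⟩ := ih (x + 1) τ (by omega) hτR hc' hD'
    refine ⟨_, τ', .loop_step ?_ hr hr', ?_, ?_⟩
    · rw [holds, hc, if_neg (by omega)]
      omega
    · rw [hcost, Nat.succ_mul]
      omega
    · rw [ho', ho, Finset.sum_range_succ', add_zero, add_assoc, add_comm (flagTerm _ _ _ _ _ _)]
      simp only [add_assoc, add_comm 1]

/-! ### The time bound -/

/-- The number of digit vectors is `(2 * N) ^ d` with `2 * N ≤ 12 * M ≤ M ^ 5`, and the time for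
each of them is polynomial in `N`. -/
theorem time_bound {a e d n N M t₁ t₂ : ℕ} (hd : 0 < d) (hN : N = (n + 2) * (d + d))
    (hM : M = max 2 (max 1 n * d)) (h₁ : t₁ ≤ a * (N + 1) ^ e)
    (h₂ : t₂ ≤ (N + N) ^ d * (a * (N + 1) ^ e + 6) + 6) (ha : 6 ≤ a) :
    t₁ + t₂ ≤ M ^ ((8 + a + 4 * e) * d) := by
  have hM2 : 2 ≤ M := hM ▸ le_max_left _ _
  have hMn : max 1 n * d ≤ M := hM ▸ le_max_right _ _
  have hN6 : N ≤ 6 * M := by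
    have : n + 2 ≤ 3 * max 1 n := by omega
    calc N = (n + 2) * (2 * d) := by rw [hN]; ring
      _ ≤ 3 * max 1 n * (2 * d) := Nat.mul_le_mul_right _ this
      _ = 6 * (max 1 n * d) := by ring
      _ ≤ 6 * M := Nat.mul_le_mul_left _ hMn
  have hpow : ∀ k, 2 ^ k ≤ M ^ k := fun k => Nat.pow_le_pow_left hM2 k
  have h3 := hpow 3
  have h4 := hpow 4
  have hL : N + 1 ≤ M ^ 4 := by
    calc N + 1 ≤ 2 ^ 3 * M := by omega
      _ ≤ M ^ 3 * M := Nat.mul_le_mul_right _ h3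
      _ = M ^ 4 := by ring
  have hB : N + N ≤ M ^ 5 := by
    calc N + N ≤ 2 ^ 4 * M := by omega
      _ ≤ M ^ 4 * M := Nat.mul_le_mul_right _ h4
      _ = M ^ 5 := by ring
  have hN0 : 0 < N := by rw [hN]; positivity
  have hE : 1 ≤ (N + 1) ^ e := Nat.one_le_pow _ _ (by omega)
  have hP : 1 ≤ (N + N) ^ d := Nat.one_le_pow _ _ (by omega)
  have hX : 6 ≤ a * (N + 1) ^ e := ha.trans (Nat.le_mul_of_pos_right _ hE)
  set X := a * (N + 1) ^ e
  set P := (N + N) ^ d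
  have hXP : X ≤ P * X := Nat.le_mul_of_pos_left _ hP
  have hXM : X ≤ M ^ (a + 4 * e) := by
    calc X ≤ M ^ a * (M ^ 4) ^ e :=
          Nat.mul_le_mul ((Nat.lt_two_pow_self).le.trans (hpow a)) (Nat.pow_le_pow_left hL e)
      _ = M ^ (a + 4 * e) := by rw [← pow_mul, ← pow_add]
  have hPM : P ≤ M ^ (5 * d) := by
    calc P ≤ (M ^ 5) ^ d := Nat.pow_le_pow_left hB d
      _ = M ^ (5 * d) := by rw [← pow_mul]
  calc t₁ + t₂ ≤ 2 ^ 2 * (P * X) := by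
        have : P * (X + 6) ≤ P * X + P * X := by
          rw [← Nat.mul_add]
          exact Nat.mul_le_mul_left _ (by omega)
        omega
    _ ≤ M ^ 2 * (M ^ (5 * d) * M ^ (a + 4 * e)) :=
        Nat.mul_le_mul (hpow 2) (Nat.mul_le_mul hPM hXM)
    _ = M ^ (2 + 5 * d + (a + 4 * e)) := by rw [← pow_add, ← pow_add]; ring_nf
    _ ≤ M ^ ((8 + a + 4 * e) * d) := by
        refine Nat.pow_le_pow_right (by omega) ?_
        have : a + 4 * e ≤ (a + 4 * e) * d := Nat.le_mul_of_pos_right _ hd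
        have : (8 + a + 4 * e) * d = 8 * d + (a + 4 * e) * d := by ring
        omega

end RealRAM

open RealRAM in
theorem mainTheorem4 :
    ∃ (prog : RealRAM.Prog) (C : ℕ),
      ∀ (d n : ℕ) (X : Set (Fin d → ℝ)) (Q : Fin n → Pyramid d) (P : Pyramid d),
        IsValidSearchSpaceVia X Q →
          ∃ (t : ℕ) (τ : RealRAM.State),
            RealRAM.Runs prog (RealRAM.volumeInput Q P) t τ ∧
            τ.output = (volume (X ∩ P.toSet)).toReal ∧
            t ≤ (max 2 (max 1 n * d)) ^ (C * d) := by
  -- The constant is read off from the text of the program: the time budget of a part of the program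
  -- is a polynomial whose coefficients have the sum `budget 1`, and whose degree is the loop depth.
  set round := Prog.seq addFlagTerm increment with hround
  set a := prepare.budget 1 + round.budget 1 + 6 with ha
  set e := max prepare.depth round.depth with he
  refine ⟨volumeProg, 8 + a + 4 * e, fun d n X Q P hX => ?_⟩
  -- There are no pyramids in dimension `0`, since the direction is an element of `Fin d`.
  have hd : 0 < d := P.dir.pos
  obtain ⟨N, hN⟩ : ∃ N, N = (n + 2) * (d + d) := ⟨_, rfl⟩
  have hNd : d + d ≤ N := hN ▸ Nat.le_mul_of_pos_left _ (by omega)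
  have hNn : n + 2 ≤ N := hN ▸ Nat.le_mul_of_pos_right _ (by omega)
  set σ₀ := volumeInput Q P with hσ₀
  have hprep := halts_prepare (L := N + 1) (σ₀ := σ₀) hN (by simp [hσ₀, volumeInput, encode])
    (by simp [hσ₀, volumeInput, encode]) (by simp [hσ₀, volumeInput, encode])
    (by simp [hσ₀, volumeInput, encode]) (by omega) (by omega) (by omega)
  obtain ⟨t₁, τ₁, hr₁, ht₁, hready⟩ := hprep
  have hF := hr₁.frame
  have hN0 : 0 < N := by omega
  have hzero : ∀ l, τ₁.nat 11 l = 0 := fun l => by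
    rw [hF.1 11 (by decide)]; simp [hσ₀, volumeInput, encode]
  obtain ⟨t₂, τ₂, hr₂, ht₂, hout⟩ := runs_sumFlags (L := N + 1) hN hN0 (by omega)
    (by omega) (by omega) le_rfl ((N + N) ^ d) 0 τ₁ (by omega) hready
    (by
      rw [hF.1 10 (by decide), if_neg (by positivity)]
      simp [hσ₀, volumeInput, encode])
    (fun l _ => by simp [hzero])
  refine ⟨t₁ + t₂, τ₂, .seq hr₁ hr₂, ?_, ?_⟩
  · have h0 : τ₁.real 1 0 = 0 := by
      rw [hF.2 1 (by decide)]; simp [hσ₀, volumeInput, encode]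
    rw [State.output, hout, h0, zero_add, hX, volume_eq_sum_flagTerm Q P, ← hN]
    simp only [zero_add, ← hσ₀]
  · have hE : ∀ p : Prog, p.depth ≤ e → p.budget 1 + 6 ≤ a →
        p.budget (N + 1) ≤ a * (N + 1) ^ e := fun p hp hpa =>
      (p.budget_le (by omega)).trans (Nat.mul_le_mul (by omega)
        (Nat.pow_le_pow_right (by omega) hp))
    refine time_bound hd hN rfl (ht₁.trans (hE _ (le_max_left _ _) (by omega))) (ht₂.trans ?_)
      (by omega)
    have := hE round (le_max_right _ _) (by omega)
    gcongr
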